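/- Let $k$ be an algebraically closed field of characteristic $0$, let $J$ be a unital Jordan algebra over $k$, and put $\partial_{a,b}c=a(bc)-b(ac)$ for $a,b,c\in J$. Let $\mathfrak G=\mathfrak{sl}_2(J)=(\mathfrak{sl}_2(k)\otimes J)\oplus\{J,J\}$ be the Tits–Allison–Gao Lie algebra, where $\{J,J\}=\bigwedge^2J/\mathrm{Span}\{a\wedge a^2 : a\in J\}$, $\{a,b\}$ is the image of $a\wedge b$, $x(a)=x\otimes a$, $\kappa$ is one half of the Killing form of $\mathfrak{sl}_2(k)$, and $$[x(a),y(b)]=[x,y](ab)+\kappa(x,y)\{a,b\},\quad [\{a,b\},x(c)]=x(\partial_{a,b}c),\quad [\{a,b\},\{c,d\}]=\{\partial_{a,b}c,d\}+\{c,\partial_{a,b}d\}.$$ Let $\{h,e,f\}$ be the standard basis of $\mathfrak{sl}_2(k)$, and put $\mathfrak G_0=h\otimes J\oplus\{J,J\}$ and $\mathfrak G_1=e\otimes J$. For a $\mathfrak G$-module $N$ and $j\in\mathbb Z$ let $N_j=\{v\in N : h(1)v=jv\}$; $N$ is bounded of level $n$ if $N=\bigoplus_{-n\le j\le n}N_j$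 and $N_n\neq 0$. Let $n\ge 0$ be an integer and let $(M,\rho)$ be a nonzero $J$-space of level $n$, that is, $M\ne0$ is a vector space with a linear map $\rho:J\to\mathrm{End}_k(M)$ such that $[\rho(a),\rho(a^2)]=0$ and $[[\rho(a),\rho(b)],\rho(c)]=4\rho(\partial_{a,b}c)$ for all $a,b,c\in J$, and $\rho(1)=n\,\mathrm{id}$. Let $M$ be the $\mathfrak G_0\oplus\mathfrak G_1$-module on which $h(a)$ acts as $\rho(a)$, $\{a,b\}$ acts as $\frac14[\rho(a),\rho(b)]$ and $\mathfrak G_1$ acts as zero, and let $V(M)=\mathcal U(\mathfrak G)\otimes_{\mathcal U(\mathfrak G_0\oplus\mathfrak G_1)}M$ be the generalized Verma module. Then the following conditions are equivalent: (1) $M$ is dominant, that is, there is a bounded $\mathfrak G$-module $N$ of level $n$ such that $M$ is isomorphic to $N_n$ as a $J$-space, where $a\in J$ acts on $N_n$ as $h(a)$; (1$'$) $V(M)$ has a $\mathfrak G$-submodule $X$ such that $V(M)/X$ is bounded of level $n$ and the natural map $M\to V(M)\to V(M)/X$ is injective; (2) $e(1)^{n+1}f(a)^{n+1}m=0$ in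 $V(M)$ for all $a\in J$ and $m\in M$; (3) for all $a\in J$, $$\sum_{\sigma\vdash n+1}\mathrm{sgn}(\sigma)\,|C_\sigma|\,\rho(a^{\sigma_1})\rho(a^{\sigma_2})\cdots\rho(a^{\sigma_m})=0,$$ where $\sigma=(\sigma_1\ge\cdots\ge\sigma_m\geq 1)$ runs over the partitions of $n+1$, $C_\sigma$ is the conjugacy class of permutations in $S_{n+1}$ of cycle type $\sigma$, and $\mathrm{sgn}(\sigma)$ is the sign of these permutations. -/

import Mathlib

open scoped TensorProduct

noncomputable section

namespace JordanSL2

/-! ## Unital Jordan algebras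

A unital Jordan algebra over `k` is a `NonAssocCommRing J` with a `k`-module structure for which the
multiplication is bilinear (`IsScalarTower k J J`, `SMulCommClass k J J`), satisfying the Jordan
identity `IsCommJordan J`. -/

section Jordan

variable {J : Type*} [NonAssocCommRing J]

/-- The powers `a ^ i` in a (power-associative) unital Jordan algebra. -/
def jpow (a : J) : ℕ → J
  | 0 => 1
  | i + 1 => a * jpow a i

variable (k : Type*) [Field k] [Module k J] [IsScalarTower k J J] [SMulCommClass k J J]

/-- The operator `∂_{a,b} = [L_a, L_b]`, that is, `∂_{a,b} c = a (b c) - b (a c)`,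
as a bilinear function of `a` and `b`. -/
def innerDer : J →ₗ[k] J →ₗ[k] Module.End k J :=
  LinearMap.mk₂ k
    (fun a b => LinearMap.mulLeft k a * LinearMap.mulLeft k b
      - LinearMap.mulLeft k b * LinearMap.mulLeft k a)
    (by intro a b c; ext d; simp [add_mul, mul_add]; abel)
    (by intro a b c; ext d; simp [smul_sub, smul_mul_assoc])
    (by intro a b c; ext d; simp [add_mul, mul_add]; abel)
    (by intro a b c; ext d; simp [smul_sub, smul_mul_assoc])

@[simp] lemma innerDer_apply (a b c : J) : innerDer k a b c = a * (b * c) - b * (a * c) := rfl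

variable [IsCommJordan J]

lemma jordan_identity (a c : J) : a * (a * a * c) = a * a * (a * c) := by
  have := IsCommJordan.lmul_comm_rmul_rmul a c
  rw [mul_comm (a * a) c, ← this, mul_comm]

/-- Linearised Jordan identity. -/
lemma jordan_linear [CharZero k] (a b c d : J) :
    (a * b) * (c * d) + (b * c) * (a * d) + (c * a) * (b * d)
      = c * ((a * b) * d) + a * ((b * c) * d) + b * ((c * a) * d) := by
  have key : ∀ a b c : J,
      (2 : k) • ((a * b) * (c * d) + (b * c) * (a * d) + (c * a) * (b * d))
      = (2 : k) • (c * ((a * b) * d) + a * ((b * c) * d) + b * ((c * a) * d)) := by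
    intro a b c
    have h1 := jordan_identity (a + b + c) d
    have h2 := jordan_identity (a + b) d
    have h3 := jordan_identity (b + c) d
    have h4 := jordan_identity (a + c) d
    have h5 := jordan_identity a d
    have h6 := jordan_identity b d
    have h7 := jordan_identity c d
    simp only [mul_add, add_mul] at h1 h2 h3 h4
    simp only [mul_comm b a, mul_comm c a, mul_comm c b] at h1 h2 h3 h4 h5 h6 h7 ⊢
    linear_combination (norm := module) h2 + h3 + h4 - h1 - h5 - h6 - h7
  exact smul_right_injective J (two_ne_zero (α := k)) (key a b c)


/-- `∂_{a,b}` is a derivation of `J`. -/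
lemma innerDer_mul [CharZero k] (a b c d : J) :
    innerDer k a b (c * d) = innerDer k a b c * d + c * innerDer k a b d := by
  have h1 := jordan_linear k c d a b
  have h2 := jordan_linear k c d b a
  simp only [innerDer_apply, sub_mul, mul_sub]
  simp only [mul_comm] at h1 h2 ⊢
  linear_combination (norm := module) h2 - h1

/-! ## The space `{J,J}` -/

/-- The subspace of `J ⊗ J` spanned by all `a ⊗ a` and all `a ⊗ a²`. -/
def relJJ (J : Type*) [NonAssocCommRing J] [Module k J] : Submodule k (J ⊗[k] J) :=
  Submodule.span k
    ({t | ∃ a : J, t = a ⊗ₜ[k] a} ∪ {t | ∃ a : J, t = a ⊗ₜ[k] (a * a)})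

/-- The space `{J,J} = (⋀² J) / Span {a ∧ a²}`, written as the quotient of `J ⊗ J` by the span of
all `a ⊗ a` (which gives `⋀² J`) and all `a ⊗ a²`. -/
abbrev JJ (J : Type*) [NonAssocCommRing J] [Module k J] : Type _ := (J ⊗[k] J) ⧸ relJJ k J

/-- The element `{a,b}`, the image of `a ∧ b` in `{J,J}`, as a bilinear function of `a`, `b`. -/
def brace : J →ₗ[k] J →ₗ[k] JJ k J :=
  (TensorProduct.mk k J J).compr₂ (relJJ k J).mkQ

lemma brace_self (a : J) : brace k a a = 0 :=
  (Submodule.Quotient.mk_eq_zero _).2 (Submodule.subset_span (Or.inl ⟨a, rfl⟩))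

lemma brace_sq (a : J) : brace k a (a * a) = 0 :=
  (Submodule.Quotient.mk_eq_zero _).2 (Submodule.subset_span (Or.inr ⟨a, rfl⟩))

lemma brace_skew (a b : J) : brace k b a = - brace k a b := by
  have h := brace_self k (a + b)
  simp only [map_add, LinearMap.add_apply, brace_self] at h
  linear_combination (norm := module) h

lemma brace_cyc [CharZero k] (a b c : J) :
    brace k (a * b) c + brace k (b * c) a + brace k (c * a) b = 0 := by
  have h1 := brace_sq k (a + b + c)
  have h2 := brace_sq k (a + b)
  have h3 := brace_sq k (b + c)
  have h4 := brace_sq k (a + c)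
  have h5 := brace_sq k a
  have h6 := brace_sq k b
  have h7 := brace_sq k c
  simp only [mul_add, add_mul, map_add, LinearMap.add_apply] at h1 h2 h3 h4
  simp only [mul_comm b a, mul_comm c a, mul_comm c b] at h1 h2 h3 h4 h5 h6 h7 ⊢
  rw [brace_skew k c (a * b), brace_skew k a (b * c), brace_skew k b (a * c)]
  apply smul_right_injective _ (two_ne_zero (α := k))
  linear_combination (norm := module) h2 + h3 + h4 - h1 - h5 - h6 - h7

/-- A linear map out of `{J,J}` is given by a bilinear map `B` with `B a a = 0 = B a a²`. -/
def JJ.lift {N : Type*} [AddCommGroup N] [Module k N] (B : J →ₗ[k] J →ₗ[k] N)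
    (h₁ : ∀ a, B a a = 0) (h₂ : ∀ a, B a (a * a) = 0) : JJ k J →ₗ[k] N :=
  (relJJ k J).liftQ (TensorProduct.lift B) (by
    refine Submodule.span_le.2 ?_
    rintro _ (⟨a, rfl⟩ | ⟨a, rfl⟩)
    · simpa using h₁ a
    · simpa using h₂ a)

@[simp] lemma JJ.lift_brace {N : Type*} [AddCommGroup N] [Module k N] (B : J →ₗ[k] J →ₗ[k] N)
    (h₁ : ∀ a, B a a = 0) (h₂ : ∀ a, B a (a * a) = 0) (a b : J) :
    JJ.lift k B h₁ h₂ (brace k a b) = B a b := by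
  exact TensorProduct.lift.tmul a b

variable {k} in
lemma JJ.induction {P : JJ k J → Prop} (z : JJ k J) (zero : P 0)
    (add : ∀ x y, P x → P y → P (x + y)) (brace : ∀ a b, P (brace k a b)) : P z := by
  obtain ⟨t, rfl⟩ := (relJJ k J).mkQ_surjective z
  induction t using TensorProduct.induction_on with
  | zero => simpa using zero
  | tmul a b => exact brace a b
  | add x y hx hy => rw [map_add]; exact add _ _ hx hy

/-- The action of `{J,J}` on `J`, with `{a,b}` acting as `∂_{a,b}`. -/
def der : JJ k J →ₗ[k] Module.End k J :=
  JJ.lift k (innerDer k)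
    (by intro a; ext c; simp)
    (by intro a; ext c; simp [jordan_identity])

@[simp] lemma der_brace (a b c : J) : der k (brace k a b) c = a * (b * c) - b * (a * c) := by
  simp [der]

lemma der_mul [CharZero k] (z : JJ k J) (c d : J) :
    der k z (c * d) = der k z c * d + c * der k z d := by
  induction z using JJ.induction with
  | zero => simp
  | add x y hx hy => simp only [map_add, LinearMap.add_apply, hx, hy, add_mul, mul_add]; abel
  | brace a b => simpa [der] using innerDer_mul k a b c d

/-- The bilinear map `(c, d) ↦ (z ↦ {z c, d} + {c, z d})`. -/
def actAux : J →ₗ[k] J →ₗ[k] (JJ k J →ₗ[k] JJ k J) :=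
  LinearMap.mk₂ k
    (fun c d => (brace k).flip d ∘ₗ (der k).flip c + brace k c ∘ₗ (der k).flip d)
    (by intro a b c; refine LinearMap.ext fun z => ?_; simp; abel)
    (by intro a b c; refine LinearMap.ext fun z => ?_; simp)
    (by intro a b c; refine LinearMap.ext fun z => ?_; simp; abel)
    (by intro a b c; refine LinearMap.ext fun z => ?_; simp)

/-- The action of `{J,J}` on itself: `z` sends `{c,d}` to `{z c, d} + {c, z d}`. -/
def act [CharZero k] : JJ k J →ₗ[k] JJ k J →ₗ[k] JJ k J :=
  (JJ.lift k (actAux k)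
    (by
      intro c; refine LinearMap.ext fun z => ?_
      simp [actAux, brace_skew k c])
    (by
      intro c; refine LinearMap.ext fun z => ?_
      have h := brace_cyc k c c (der k z c)
      have s := brace_skew k (der k z c) (c * c)
      have t := brace_skew k c (c * der k z c)
      simp only [actAux, LinearMap.mk₂_apply, LinearMap.add_apply, LinearMap.comp_apply,
        LinearMap.flip_apply, der_mul, map_add, LinearMap.zero_apply]
      simp only [mul_comm _ c] at h s t ⊢
      linear_combination (norm := module) s + t + t - h)).flip

@[simp] lemma act_brace [CharZero k] (z : JJ k J) (c d : J) :
    act k z (brace k c d) = brace k (der k z c) d + brace k c (der k z d) := by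
  simp [act, actAux]

lemma act_skew [CharZero k] (z w : JJ k J) : act k z w = - act k w z := by
  induction z using JJ.induction with
  | zero => simp
  | add x y hx hy => simp only [map_add, LinearMap.add_apply, hx, hy]; abel
  | brace a b =>
    induction w using JJ.induction with
    | zero => simp
    | add x y hx hy => simp only [map_add, LinearMap.add_apply, hx, hy]; abel
    | brace c d =>
      have h1 := brace_cyc k a (b * c) d
      have h2 := brace_cyc k b (a * c) d
      have h3 := brace_cyc k a (b * d) c
      have h4 := brace_cyc k b (a * d) c
      have s1 := brace_skew k (a * c) (b * d)
      have s2 := brace_skew k (a * d) (b * c)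
      have s3 := brace_skew k c (a * (b * d))
      have s4 := brace_skew k c (b * (a * d))
      have s5 := brace_skew k a (c * (d * b))
      have s6 := brace_skew k a (d * (c * b))
      simp only [act_brace, der_brace, map_sub, LinearMap.sub_apply]
      simp only [mul_comm] at h1 h2 h3 h4 s1 s2 s3 s4 s5 s6 ⊢
      linear_combination (norm := module) h1 - h2 - h3 + h4 + s3 - s4 + s5 - s6 + s1 - s2

lemma act_self [CharZero k] (z : JJ k J) : act k z z = 0 := by
  have h := act_skew k z z
  apply smul_right_injective _ (two_ne_zero (α := k))
  linear_combination (norm := module) h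

lemma der_act [CharZero k] (z w : JJ k J) (c : J) :
    der k (act k z w) c = der k z (der k w c) - der k w (der k z c) := by
  induction w using JJ.induction with
  | zero => simp
  | add x y hx hy => simp only [map_add, LinearMap.add_apply, hx, hy]; abel
  | brace a b =>
    simp only [act_brace, map_add, LinearMap.add_apply, der_brace, map_sub, der_mul]
    simp only [mul_add]
    abel

lemma act_act [CharZero k] (z w u : JJ k J) :
    act k z (act k w u) = act k (act k z w) u + act k w (act k z u) := by
  induction u using JJ.induction with
  | zero => simp
  | add x y hx hy => simp only [map_add, hx, hy]; abel
  | brace a b =>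
    simp only [act_brace, map_add, der_act, map_sub, LinearMap.sub_apply]
    abel


end Jordan

/-! ## The Lie algebra `sl₂(J)` -/

section LieAlg

/-- The vector space `sl₂(J) = (sl₂(k) ⊗ J) ⊕ {J,J}`. With respect to the standard basis `e, h, f` of
`sl₂(k)`, the element `⟨a, b, c, z⟩` is `e(a) + h(b) + f(c) + z`, where `x(a) = x ⊗ a`. -/
@[ext]
structure SL2J (k J : Type*) [Field k] [NonAssocCommRing J] [Module k J] where
  /-- The coefficient of `e`. -/
  e : J
  /-- The coefficient of `h`. -/
  h : J
  /-- The coefficient of `f`. -/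
  f : J
  /-- The component in `{J,J}`. -/
  z : JJ k J

namespace SL2J

variable (k J : Type*) [Field k] [NonAssocCommRing J] [Module k J]

/-- The identification with `J × J × J × {J,J}`, used to transfer the vector space structure. -/
def equivProd : SL2J k J ≃ J × J × J × JJ k J where
  toFun x := (x.e, x.h, x.f, x.z)
  invFun p := ⟨p.1, p.2.1, p.2.2.1, p.2.2.2⟩
  left_inv _ := rfl
  right_inv _ := rfl

instance : AddCommGroup (SL2J k J) := (equivProd k J).addCommGroup

instance : Module k (SL2J k J) := (equivProd k J).module k

variable {k J}

@[simp] lemma add_e (x y : SL2J k J) : (x + y).e = x.e + y.e := rfl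
@[simp] lemma add_h (x y : SL2J k J) : (x + y).h = x.h + y.h := rfl
@[simp] lemma add_f (x y : SL2J k J) : (x + y).f = x.f + y.f := rfl
@[simp] lemma add_z (x y : SL2J k J) : (x + y).z = x.z + y.z := rfl
@[simp] lemma zero_e : (0 : SL2J k J).e = 0 := rfl
@[simp] lemma zero_h : (0 : SL2J k J).h = 0 := rfl
@[simp] lemma zero_f : (0 : SL2J k J).f = 0 := rfl
@[simp] lemma zero_z : (0 : SL2J k J).z = 0 := rfl
@[simp] lemma smul_e (r : k) (x : SL2J k J) : (r • x).e = r • x.e := rfl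
@[simp] lemma smul_h (r : k) (x : SL2J k J) : (r • x).h = r • x.h := rfl
@[simp] lemma smul_f (r : k) (x : SL2J k J) : (r • x).f = r • x.f := rfl
@[simp] lemma smul_z (r : k) (x : SL2J k J) : (r • x).z = r • x.z := rfl

variable [IsScalarTower k J J] [SMulCommClass k J J] [IsCommJordan J] [CharZero k]

/-- The bracket of `sl₂(J)`. It is the bilinear skew-symmetric bracket determined by
* `[x(a), y(b)] = [x,y](ab) + κ(x,y) {a,b}`,
* `[{a,b}, x(c)] = x(∂_{a,b} c)`,
* `[{a,b}, {c,d}] = {∂_{a,b} c, d} + {c, ∂_{a,b} d}`,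

where `[h,e] = 2e`, `[h,f] = -2f`, `[e,f] = h`, and `κ` is one half of the Killing form of `sl₂(k)`,
that is, `κ(h,h) = 4`, `κ(e,f) = κ(f,e) = 2`, and `κ` vanishes on the other pairs of basis
vectors. -/
instance : Bracket (SL2J k J) (SL2J k J) where
  bracket x y :=
    { e := (2 : k) • (x.h * y.e - x.e * y.h) + der k x.z y.e - der k y.z x.e
      h := x.e * y.f - x.f * y.e + der k x.z y.h - der k y.z x.h
      f := (2 : k) • (x.f * y.h - x.h * y.f) + der k x.z y.f - der k y.z x.f
      z := (4 : k) • brace k x.h y.h + (2 : k) • (brace k x.e y.f + brace k x.f y.e)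
        + act k x.z y.z }

lemma lie_e (x y : SL2J k J) : ⁅x, y⁆.e =
    (2 : k) • (x.h * y.e - x.e * y.h) + der k x.z y.e - der k y.z x.e := rfl
lemma lie_h (x y : SL2J k J) : ⁅x, y⁆.h =
    x.e * y.f - x.f * y.e + der k x.z y.h - der k y.z x.h := rfl
lemma lie_f (x y : SL2J k J) : ⁅x, y⁆.f =
    (2 : k) • (x.f * y.h - x.h * y.f) + der k x.z y.f - der k y.z x.f := rfl
lemma lie_z (x y : SL2J k J) : ⁅x, y⁆.z =
    (4 : k) • brace k x.h y.h + (2 : k) • (brace k x.e y.f + brace k x.f y.e)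
      + act k x.z y.z := rfl

instance : LieRing (SL2J k J) where
  add_lie x y z := by
    ext <;> simp only [lie_e, lie_h, lie_f, lie_z, add_e, add_h, add_f, add_z, add_mul, mul_add,
      map_add, LinearMap.add_apply] <;> module
  lie_add x y z := by
    ext <;> simp only [lie_e, lie_h, lie_f, lie_z, add_e, add_h, add_f, add_z, add_mul, mul_add,
      map_add, LinearMap.add_apply] <;> module
  lie_self x := by
    ext
    · simp [lie_e, mul_comm]
    · simp [lie_h, mul_comm]
    · simp [lie_f, mul_comm]
    · simp [lie_z, brace_self, act_self, brace_skew k x.e x.f]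
  leibniz_lie x y z := by
    ext
    · simp only [lie_e, lie_h, lie_f, lie_z, add_e, add_h, add_f, map_add, map_sub, map_smul,
        LinearMap.add_apply, LinearMap.smul_apply, der_act, der_brace, der_mul, mul_add, add_mul,
        mul_sub, sub_mul, smul_mul_assoc, mul_smul_comm, smul_add, smul_sub]
      simp only [mul_comm]
      module
    · simp only [lie_e, lie_h, lie_f, lie_z, add_e, add_h, add_f, map_add, map_sub, map_smul,
        LinearMap.add_apply, LinearMap.smul_apply, der_act, der_brace, der_mul, mul_add, add_mul,
        mul_sub, sub_mul, smul_mul_assoc, mul_smul_comm, smul_add, smul_sub]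
      simp only [mul_comm]
      module
    · simp only [lie_e, lie_h, lie_f, lie_z, add_e, add_h, add_f, map_add, map_sub, map_smul,
        LinearMap.add_apply, LinearMap.smul_apply, der_act, der_brace, der_mul, mul_add, add_mul,
        mul_sub, sub_mul, smul_mul_assoc, mul_smul_comm, smul_add, smul_sub]
      simp only [mul_comm]
      module
    · have hm : ∀ a b c : J, brace k (a * b) c = - brace k c (a * b) := fun a b c =>
        brace_skew k c (a * b)
      have hd : ∀ (w : JJ k J) (a c : J), brace k (der k w a) c = - brace k c (der k w a) :=
        fun w a c => brace_skew k c (der k w a)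
      have ha : ∀ (w : JJ k J) (a b : J), act k (brace k a b) w
          = - (brace k (der k w a) b + brace k a (der k w b)) := fun w a b => by
        rw [act_skew, act_brace]
      have h1 := brace_cyc k x.h y.e z.f
      have h2 := brace_cyc k x.h y.f z.e
      have h3 := brace_cyc k x.e y.h z.f
      have h4 := brace_cyc k x.f y.h z.e
      have h5 := brace_cyc k x.e y.f z.h
      have h6 := brace_cyc k x.f y.e z.h
      simp only [lie_e, lie_h, lie_f, lie_z, add_z, map_add, map_sub, map_smul,
        LinearMap.add_apply, LinearMap.sub_apply, LinearMap.smul_apply, act_act k x.z y.z z.z,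
        act_brace, ha, smul_add, smul_sub]
      simp only [hm, hd] at h1 h2 h3 h4 h5 h6 ⊢
      simp only [mul_comm] at h1 h2 h3 h4 h5 h6 ⊢
      linear_combination (norm := skip) (-4 : k) • h1 + (4 : k) • h2
        + (4 : k) • h3 - (4 : k) • h4 - (4 : k) • h5 + (4 : k) • h6
      module

instance : LieAlgebra k (SL2J k J) where
  lie_smul r x y := by
    ext <;> simp only [lie_e, lie_h, lie_f, lie_z, smul_e, smul_h, smul_f, smul_z, map_smul,
      mul_smul_comm, smul_mul_assoc, LinearMap.smul_apply] <;> module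

variable (k)

/-- The element `e(a) = e ⊗ a`. -/
def E (a : J) : SL2J k J := ⟨a, 0, 0, 0⟩

/-- The element `h(a) = h ⊗ a`. -/
def H (a : J) : SL2J k J := ⟨0, a, 0, 0⟩

/-- The element `f(a) = f ⊗ a`. -/
def F (a : J) : SL2J k J := ⟨0, 0, a, 0⟩

variable (J) in
/-- The subalgebra `𝔊₀ ⊕ 𝔊₁ = (h ⊗ J ⊕ {J,J}) ⊕ (e ⊗ J)` of `𝔊 = sl₂(J)`. -/
def parabolic : LieSubalgebra k (SL2J k J) where
  carrier := {x | x.f = 0}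
  add_mem' {x y} hx hy := by simp_all
  zero_mem' := rfl
  smul_mem' r x hx := by simp_all
  lie_mem' {x y} hx hy := by simp_all [lie_f]

end SL2J

end LieAlg

/-! ## Bounded modules -/

section Bounded

variable (k J : Type*) [Field k] [CharZero k] [NonAssocCommRing J] [Module k J]
  [IsScalarTower k J J] [SMulCommClass k J J] [IsCommJordan J]
  (N : Type*) [AddCommGroup N] [Module k N] [LieRingModule (SL2J k J) N] [LieModule k (SL2J k J) N]

/-- The weight space `N_j = {v | h(1) v = j v}`. -/
def weightSpace (j : ℤ) : Submodule k N where
  carrier := {v | ⁅SL2J.H k (1 : J), v⁆ = (j : k) • v}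
  add_mem' {v w} hv hw := by
    have hv : ⁅SL2J.H k (1 : J), v⁆ = (j : k) • v := hv
    have hw : ⁅SL2J.H k (1 : J), w⁆ = (j : k) • w := hw
    show ⁅SL2J.H k (1 : J), v + w⁆ = (j : k) • (v + w)
    rw [lie_add, hv, hw, smul_add]
  zero_mem' := by
    show ⁅SL2J.H k (1 : J), (0 : N)⁆ = (j : k) • (0 : N)
    simp
  smul_mem' r v hv := by
    have hv : ⁅SL2J.H k (1 : J), v⁆ = (j : k) • v := hv
    show ⁅SL2J.H k (1 : J), r • v⁆ = (j : k) • (r • v)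
    rw [lie_smul, hv, smul_comm]

/-- `N` is a bounded weight module of level `n`: `N = ⨁_{-n ≤ j ≤ n} N_j` and `N_n ≠ 0`. -/
def IsBoundedOfLevel (n : ℕ) : Prop :=
  DirectSum.IsInternal (fun j : Set.Icc (-(n : ℤ)) (n : ℤ) => weightSpace k J N j) ∧
    weightSpace k J N n ≠ ⊥

end Bounded

/-! ## `J`-spaces and generalized Verma modules -/

/-- A `J`-space structure on the vector space `M`. -/
structure JSpace (k J M : Type*) [Field k] [NonAssocCommRing J] [Module k J]
    [IsScalarTower k J J] [SMulCommClass k J J] [AddCommGroup M] [Module k M] where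
  /-- The action of `J`. -/
  ρ : J →ₗ[k] Module.End k M
  /-- `[ρ(a), ρ(a²)] = 0`. -/
  lie_sq : ∀ a, ρ a * ρ (a * a) - ρ (a * a) * ρ a = 0
  /-- `[[ρ(a), ρ(b)], ρ(c)] = 4 ρ(∂_{a,b} c)`. -/
  lie_lie : ∀ a b c, (ρ a * ρ b - ρ b * ρ a) * ρ c - ρ c * (ρ a * ρ b - ρ b * ρ a)
    = (4 : k) • ρ (innerDer k a b c)

namespace JSpace

variable {k J M : Type*} [Field k] [NonAssocCommRing J] [Module k J]
  [IsScalarTower k J J] [SMulCommClass k J J] [AddCommGroup M] [Module k M]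

/-- The `J`-space has level `n`: `ρ(1) = n id`. -/
def IsOfLevel (V : JSpace k J M) (n : ℕ) : Prop := V.ρ 1 = (n : k) • (1 : Module.End k M)

variable [CharZero k] [IsCommJordan J] (V : JSpace k J M)

/-- The action of `{J,J}` on a `J`-space: `{a,b}` acts as `(1/4) [ρ(a), ρ(b)]`, as is forced by
`[h(a), h(b)] = 4 {a,b}`. -/
def braceAction : JJ k J →ₗ[k] Module.End k M :=
  JJ.lift k
    (LinearMap.mk₂ k (fun a b => (4 : k)⁻¹ • (V.ρ a * V.ρ b - V.ρ b * V.ρ a))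
      (by intro a b c; simp only [map_add, add_mul, mul_add]; module)
      (by intro r a b; simp only [map_smul, smul_mul_assoc, mul_smul_comm]; module)
      (by intro a b c; simp only [map_add, add_mul, mul_add]; module)
      (by intro r a b; simp only [map_smul, smul_mul_assoc, mul_smul_comm]; module))
    (by intro a; simp)
    (by intro a; simp [V.lie_sq a])

@[simp] lemma braceAction_brace (a b : J) :
    V.braceAction (brace k a b) = (4 : k)⁻¹ • (V.ρ a * V.ρ b - V.ρ b * V.ρ a) := by
  simp [braceAction]

/-- The action of `𝔊₀ ⊕ 𝔊₁` on a `J`-space: `h(a)` acts as `ρ(a)`, `{J,J}` as above, and `𝔊₁` acts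
as zero. -/
def parabolicAction : SL2J.parabolic k J →ₗ[k] Module.End k M where
  toFun x := V.ρ x.1.h + V.braceAction x.1.z
  map_add' x y := by simp; abel
  map_smul' r x := by simp

lemma braceAction_lie_ρ (z : JJ k J) (c : J) :
    V.braceAction z * V.ρ c - V.ρ c * V.braceAction z = V.ρ (der k z c) := by
  induction z using JJ.induction with
  | zero => simp
  | add x y hx hy =>
    simp only [map_add, LinearMap.add_apply, ← hx, ← hy, add_mul, mul_add]; abel
  | brace a b =>
    have h4 : (4 : k) ≠ 0 := by norm_num
    have h := V.lie_lie a b c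
    rw [braceAction_brace, smul_mul_assoc, mul_smul_comm, ← smul_sub, h, smul_smul,
      inv_mul_cancel₀ h4, one_smul, der_brace, innerDer_apply]

lemma braceAction_lie (z w : JJ k J) :
    V.braceAction z * V.braceAction w - V.braceAction w * V.braceAction z
      = V.braceAction (act k z w) := by
  induction w using JJ.induction with
  | zero => simp
  | add x y hx hy =>
    simp only [map_add, ← hx, ← hy, add_mul, mul_add]; abel
  | brace a b =>
    simp only [act_brace, map_add, braceAction_brace, ← V.braceAction_lie_ρ, mul_smul_comm,
      smul_mul_assoc, mul_sub, sub_mul, mul_assoc]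
    module

/-- `M` is a module over the Lie algebra `𝔊₀ ⊕ 𝔊₁`. -/
lemma parabolicAction_lie (x y : SL2J.parabolic k J) :
    V.parabolicAction ⁅x, y⁆ = V.parabolicAction x * V.parabolicAction y
      - V.parabolicAction y * V.parabolicAction x := by
  obtain ⟨x, hx⟩ := x
  obtain ⟨y, hy⟩ := y
  have hx : x.f = 0 := hx
  have hy : y.f = 0 := hy
  have h1 := V.braceAction_lie_ρ x.z y.h
  have h2 := V.braceAction_lie_ρ y.z x.h
  have h3 := V.braceAction_lie x.z y.z
  have h4 : (4 : k) • V.braceAction (brace k x.h y.h) = V.ρ x.h * V.ρ y.h - V.ρ y.h * V.ρ x.h := by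
    rw [braceAction_brace, smul_smul, mul_inv_cancel₀ (by norm_num), one_smul]
  simp only [parabolicAction, LinearMap.coe_mk, AddHom.coe_mk, LieSubalgebra.coe_bracket,
    SL2J.lie_h, SL2J.lie_z, hx, hy, map_add, map_sub, map_smul, mul_zero, zero_mul, map_zero,
    LinearMap.zero_apply, smul_zero, sub_zero, add_zero, ← h1, ← h2, ← h3, h4, add_mul, mul_add]
  abel

/-- The span of all `u x ⊗ m - u ⊗ x m` with `u ∈ U(𝔊)`, `x ∈ 𝔊₀ ⊕ 𝔊₁`, `m ∈ M`; that is, the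
`U(𝔊)`-submodule of `U(𝔊) ⊗ M` generated by all `x ⊗ m - 1 ⊗ x m`. -/
def vermaRel : Submodule (UniversalEnvelopingAlgebra k (SL2J k J))
    (UniversalEnvelopingAlgebra k (SL2J k J) ⊗[k] M) :=
  Submodule.span _ {t | ∃ (x : SL2J.parabolic k J) (m : M),
    t = UniversalEnvelopingAlgebra.ι k (x : SL2J k J) ⊗ₜ[k] m - 1 ⊗ₜ[k] V.parabolicAction x m}

/-- The generalized Verma module `V(M) = U(𝔊) ⊗_{U(𝔊₀ ⊕ 𝔊₁)} M`. -/
abbrev Verma : Type _ := (UniversalEnvelopingAlgebra k (SL2J k J) ⊗[k] M) ⧸ V.vermaRel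

/-- The natural map `M → V(M)`, `m ↦ 1 ⊗ m`. -/
def toVerma : M →ₗ[k] V.Verma :=
  (V.vermaRel.mkQ.restrictScalars k) ∘ₗ
    TensorProduct.mk k (UniversalEnvelopingAlgebra k (SL2J k J)) M 1

section

attribute [local instance 100] LieRing.ofAssociativeRing

lemma ι_lie (x y : SL2J k J) : UniversalEnvelopingAlgebra.ι k ⁅x, y⁆ =
    UniversalEnvelopingAlgebra.ι k x * UniversalEnvelopingAlgebra.ι k y
      - UniversalEnvelopingAlgebra.ι k y * UniversalEnvelopingAlgebra.ι k x := by
  rw [LieHom.map_lie, LieRing.of_associative_ring_bracket]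

end

/-- `V(M)` is a `𝔊`-module through left multiplication by `𝔊 ⊆ U(𝔊)`. -/
instance : LieRingModule (SL2J k J) V.Verma where
  bracket x v := UniversalEnvelopingAlgebra.ι k x • v
  add_lie x y v := by
    show UniversalEnvelopingAlgebra.ι k (x + y) • v = _ • v + _ • v
    rw [map_add, add_smul]
  lie_add x v w := smul_add _ v w
  leibniz_lie x y v := by
    show _ • _ • v = UniversalEnvelopingAlgebra.ι k ⁅x, y⁆ • v + _ • _ • v
    rw [ι_lie, sub_smul, mul_smul, mul_smul,
      sub_add_cancel]

instance : LieModule k (SL2J k J) V.Verma where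
  smul_lie r x v := by
    show UniversalEnvelopingAlgebra.ι k (r • x) • v = r • _ • v
    rw [map_smul, smul_assoc]
  lie_smul r x v := by
    show UniversalEnvelopingAlgebra.ι k x • r • v = r • _ • v
    rw [smul_comm]

/-- `V(M)` has a bounded `M`-quotient of level `n`: there is a submodule `X` such that `V(M)/X` is
bounded of level `n` and the natural map `M → V(M) → V(M)/X` is injective. -/
def HasBoundedQuotient (n : ℕ) : Prop :=
  ∃ X : LieSubmodule k (SL2J k J) V.Verma,
    IsBoundedOfLevel k J (V.Verma ⧸ X) n ∧
      Function.Injective (fun m : M => LieSubmodule.Quotient.mk' X (V.toVerma m))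

/-- `ρ_σ(a) = ρ(a^{σ₁}) ρ(a^{σ₂}) ⋯ ρ(a^{σ_m})` for the partition `σ = (σ₁ ≥ σ₂ ≥ ⋯ ≥ σ_m)`. -/
def ρPartition (V : JSpace k J M) {N : ℕ} (σ : N.Partition) (a : J) : Module.End k M :=
  ((σ.parts.sort (· ≥ ·)).map fun i => V.ρ (jpow a i)).prod

end JSpace

section Dominant

universe u v w

/-- A `J`-space `M` is dominant of level `n` if it is (isomorphic to) the top weight space `N_n` of
some bounded `sl₂(J)`-module `N` of level `n`, where `a ∈ J` acts on `N_n` as `h(a)`. -/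
def JSpace.IsDominant {k : Type u} {J : Type v} {M : Type w} [Field k] [CharZero k]
    [NonAssocCommRing J] [Module k J] [IsScalarTower k J J] [SMulCommClass k J J] [IsCommJordan J]
    [AddCommGroup M] [Module k M] (V : JSpace k J M) (n : ℕ) : Prop :=
  ∃ (N : Type (max u v w)) (_ : AddCommGroup N) (_ : Module k N)
    (_ : LieRingModule (SL2J k J) N) (_ : LieModule k (SL2J k J) N),
    IsBoundedOfLevel k J N n ∧
      ∃ φ : M ≃ₗ[k] weightSpace k J N n,
        ∀ (a : J) (m : M), (φ (V.ρ a m) : N) = ⁅SL2J.H k a, (φ m : N)⁆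

end Dominant

/-! ## Conjugacy classes of the symmetric group -/

/-- The conjugacy class `C_σ` of permutations in `S_N` with cycle structure `σ`. -/
def conjClass {N : ℕ} (σ : N.Partition) : Finset (Equiv.Perm (Fin N)) :=
  {g | g.partition.parts = σ.parts}

/-- The sign of the permutations with cycle structure `σ`: a cycle of length `i` contributes
`-(-1)^i`. -/
def signPartition {N : ℕ} (σ : N.Partition) : ℤ := (σ.parts.map fun i => -(-1 : ℤ) ^ i).prod

lemma sign_of_mem_conjClass {N : ℕ} (σ : N.Partition) (g : Equiv.Perm (Fin N))
    (hg : g ∈ conjClass σ) : (Equiv.Perm.sign g : ℤ) = signPartition σ := by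
  have hg : g.partition.parts = σ.parts := by simpa [conjClass] using hg
  rw [signPartition, ← hg, Equiv.Perm.parts_partition, Equiv.Perm.sign_of_cycleType']
  induction g.cycleType using Multiset.induction_on with
  | empty => simp
  | cons i s ih => simpa using ih

end JordanSL2
end

/-!
Call a linear map `g` from `M` to a `𝔊`-module `N` a highest weight map if it is
`𝔊₀ ⊕ 𝔊₁`-linear. Moving `e(1)ⁿ⁺¹` past `f(a)ⁿ⁺¹` turns `e(1)ⁿ⁺¹ f(a)ⁿ⁺¹ g(m)` into
`(n + 1)! g(q m)`, where the operator `q` satisfies the recursion of Newton's identities for the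
commuting "power sums" `ρ(aⁱ)`. Hence `q` is `(n + 1)!` times an elementary symmetric function, that
is, the sum over partitions in (3). As `M` embeds into `V(M)`, this gives (2) ⇔ (3), and (3) holds
as soon as `M` embeds into the top of a bounded module, where `f(a)ⁿ⁺¹ m` vanishes for reasons of
weight.

Conversely, `M` embeds into the module `C` coinduced from the `𝔊₋₁ ⊕ 𝔊₀`-module `M`, in which a
vector of the `r`-th piece `f(J)ʳ M` vanishes once it is killed by all `e(b₁) ⋯ e(bⱼ)` for some
`j ≤ r`. If (3) holds, then `e(1)ⁿ⁺¹` kills `f(J)ⁿ⁺¹ M`, by polarization; commuting with the `h(b)`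
replaces the factors `e(1)` one by one by arbitrary `e(b)`, so `f(J)ⁿ⁺¹ M = 0` in `C`, and the image
of `V(M)` in `C` is a bounded quotient of `V(M)` into which `M` embeds.
-/

noncomputable section

namespace JordanSL2

section Ring

variable {R : Type*} [Ring R]

lemma mul_pow_succ_of_mul_eq_add {x h y : R} (hhx : h * x = x * h + 2 • y) (hxy : Commute x y)
    (N : ℕ) : h * x ^ (N + 1) = x ^ (N + 1) * h + (2 * (N + 1)) • (y * x ^ N) := by
  induction N with
  | zero => simpa using hhx
  | succ N ih =>
    have hx : x ^ (N + 1) * y = y * x ^ (N + 1) := hxy.pow_left (N + 1)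
    rw [pow_succ x (N + 1), ← mul_assoc, ih, add_mul, mul_assoc (x ^ (N + 1)), hhx, mul_add,
      mul_smul_comm, hx, smul_mul_assoc, mul_assoc y, ← pow_succ, mul_assoc]
    module

lemma two_nsmul_pow_succ_mul {x h f y : R} (hxf : x * f = f * x + h)
    (hhx : h * x = x * h + 2 • y) (hxy : Commute x y) (N : ℕ) :
    2 • (x ^ (N + 1) * f) = 2 • (f * x ^ (N + 1)) + (N + 1) • (x ^ N * h + h * x ^ N) := by
  induction N with
  | zero => rw [zero_add, pow_one, pow_zero, hxf, one_mul, mul_one]; module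
  | succ N ih =>
    have hxh : x * h * x ^ N = h * x ^ (N + 1) - 2 • (y * x ^ N) := by
      rw [eq_sub_of_add_eq hhx.symm, sub_mul, mul_assoc h, ← pow_succ', smul_mul_assoc]
    have hxfx : x * f * x ^ (N + 1) = f * x ^ (N + 1 + 1) + h * x ^ (N + 1) := by
      rw [hxf, add_mul, mul_assoc f, ← pow_succ']
    calc 2 • (x ^ (N + 1 + 1) * f) = x * (2 • (x ^ (N + 1) * f)) := by
          rw [pow_succ' x (N + 1), mul_smul_comm, mul_assoc]
      _ = 2 • (x * f * x ^ (N + 1)) + (N + 1) • (x ^ (N + 1) * h + x * h * x ^ N) := by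
          rw [ih, mul_add, mul_smul_comm, mul_smul_comm, mul_add, pow_succ' x N]
          simp only [mul_assoc]
      _ = _ := by
          rw [hxfx, hxh]
          linear_combination (norm := module) mul_pow_succ_of_mul_eq_add hhx hxy N

end Ring

section Polarization

variable {k V : Type*} [Field k] [AddCommGroup V] [Module k V]

lemma eq_zero_of_sum_pow_smul_eq_zero [Infinite k] {N : ℕ} {w : ℕ → V}
    (h : ∀ t : k, ∑ i ∈ Finset.range N, t ^ i • w i = 0) {i : ℕ} (hi : i < N) : w i = 0 := by
  refine (Module.forall_dual_apply_eq_zero_iff k _).1 fun φ => ?_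
  let p : Polynomial k := ∑ i ∈ Finset.range N, Polynomial.monomial i (φ (w i))
  have hp : p = 0 := Polynomial.funext fun t => by
    simpa [p, Polynomial.eval_finsetSum, mul_comm] using congrArg φ (h t)
  simpa [p, Polynomial.finsetSum_coeff, Polynomial.coeff_monomial, hi] using
    congrArg (Polynomial.coeff · i) hp

lemma apply_pow_apply_mem_of_forall_pow_succ_mem [CharZero k] {U : Type*} [AddCommGroup U]
    [Module k U] {A : U →ₗ[k] Module.End k V} (hA : ∀ a b, Commute (A a) (A b))
    {W : Submodule k V} {s : ℕ} {v : V} (h : ∀ a, (A a ^ (s + 1)) v ∈ W) (a c : U) :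
    A c ((A a ^ s) v) ∈ W := by
  have hpow (t : k) : ∑ i ∈ Finset.range (s + 1 + 1), t ^ i •
      (s + 1).choose i • W.mkQ ((A c ^ i * A a ^ (s + 1 - i)) v) = 0 := by
    have hexpand : ∑ i ∈ Finset.range (s + 1 + 1), t ^ i •
        (s + 1).choose i • (A c ^ i * A a ^ (s + 1 - i)) v = (A (t • c + a) ^ (s + 1)) v := by
      rw [map_add, map_smul, ((hA c a).smul_left t).add_pow, LinearMap.sum_apply]
      refine Finset.sum_congr rfl fun i _ => ?_
      rw [smul_pow, ← Nat.cast_comm, ← nsmul_eq_mul, smul_mul_assoc, LinearMap.smul_apply,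
        LinearMap.smul_apply, smul_comm]
    rw [← (Submodule.Quotient.mk_eq_zero W).2 (h (t • c + a)), ← hexpand, ← Submodule.mkQ_apply,
      map_sum]
    simp only [map_smul, map_nsmul]
  have h1 := eq_zero_of_sum_pow_smul_eq_zero hpow (show 1 < s + 1 + 1 by omega)
  rw [Nat.choose_one_right, pow_one, Nat.add_sub_cancel, ← Nat.cast_smul_eq_nsmul k] at h1
  exact (Submodule.Quotient.mk_eq_zero W).1
    ((smul_eq_zero.1 h1).resolve_left (Nat.cast_ne_zero.2 s.succ_ne_zero))

end Polarization

/-! ## Newton sums and partitions -/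

section NewtonSum

/-- The quantity `N! ∑ᵢ (-1)ⁱ e_{N-i} p_{j+i}`, where the `eᵢ` are the elementary symmetric
functions with power sums `pᵢ`, written as a recursion that makes sense in every ring. By Newton's
identities, `newtonSum p N 1` is `(N + 1)! e_{N+1}`. -/
def newtonSum {A : Type*} [Ring A] (p : ℕ → A) : ℕ → ℕ → A
  | 0, j => p j
  | N + 1, j => newtonSum p N 1 * p j - (N + 1) • newtonSum p N (j + 1)

variable {A B : Type*} [Ring A] [Ring B]

lemma map_newtonSum (f : A →+* B) (p : ℕ → A) (N j : ℕ) :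
    f (newtonSum p N j) = newtonSum (fun i => f (p i)) N j := by
  induction N generalizing j with
  | zero => rfl
  | succ N ih => rw [newtonSum, newtonSum, map_sub, map_mul, map_nsmul, ih, ih]

lemma commute_newtonSum {p : ℕ → A} {x : A} (h : ∀ i, Commute x (p i)) (N j : ℕ) :
    Commute x (newtonSum p N j) := by
  induction N generalizing j with
  | zero => exact h j
  | succ N ih => exact ((ih 1).mul_right (h j)).sub_right ((ih (j + 1)).smul_right _)

end NewtonSum

section CycleType

/-- The order `∏ i ^ mᵢ mᵢ!` of the centralizer of a permutation with cycle type `s` (fixed points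
included), where `mᵢ` is the multiplicity of `i` in `s`. -/
def centralizerOrder (s : Multiset ℕ) : ℕ := s.prod * ∏ i ∈ s.toFinset, (s.count i).factorial

lemma centralizerOrder_pos {s : Multiset ℕ} (hs : ∀ i ∈ s, 0 < i) : 0 < centralizerOrder s :=
  Nat.mul_pos (Multiset.prod_pos hs) (Finset.prod_pos fun _ _ => Nat.factorial_pos _)

lemma centralizerOrder_cons (i : ℕ) (s : Multiset ℕ) :
    centralizerOrder (i ::ₘ s) = i * (s.count i + 1) * centralizerOrder s := by
  have extend {t : Multiset ℕ} (ht : t.toFinset ⊆ insert i s.toFinset) :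
      ∏ j ∈ t.toFinset, (t.count j).factorial
        = (t.count i).factorial * ∏ j ∈ s.toFinset.erase i, (t.count j).factorial := by
    rw [Finset.prod_subset ht fun j _ hj => by
        rw [Multiset.count_eq_zero_of_notMem (Multiset.mem_toFinset.not.1 hj), Nat.factorial_zero],
      ← Finset.mul_prod_erase _ _ (Finset.mem_insert_self i _), Finset.erase_insert_eq_erase]
  have hcount : ∀ j ∈ s.toFinset.erase i, ((i ::ₘ s).count j).factorial = (s.count j).factorial :=
    fun j hj => by rw [Multiset.count_cons_of_ne (Finset.ne_of_mem_erase hj)]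
  rw [centralizerOrder, centralizerOrder, extend (Finset.subset_insert _ _),
    extend (Multiset.toFinset_cons i s).le, Finset.prod_congr rfl hcount, Multiset.prod_cons,
    Multiset.count_cons_self, Nat.factorial_succ]
  ring

lemma centralizerOrder_add_replicate_one {s : Multiset ℕ} (hs : 1 ∉ s) (c : ℕ) :
    centralizerOrder (s + Multiset.replicate c 1) = c.factorial * centralizerOrder s := by
  induction c with
  | zero => simp
  | succ c ih =>
    rw [Multiset.replicate_succ, Multiset.add_cons, centralizerOrder_cons, ih, Multiset.count_add,
      Multiset.count_replicate_self, Multiset.count_eq_zero_of_notMem hs, Nat.factorial_succ]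
    ring

variable {N : ℕ} (σ : N.Partition)

lemma parts_eq_filter_add_replicate :
    σ.parts = σ.parts.filter (2 ≤ ·) + Multiset.replicate (σ.parts.count 1) 1 := by
  conv_lhs => rw [← Multiset.filter_add_not (2 ≤ ·) σ.parts]
  rw [← Multiset.filter_eq']
  congr 1
  refine Multiset.filter_congr fun i hi => ?_
  have := σ.parts_pos hi
  omega

lemma sum_filter_parts_add_count_one :
    (σ.parts.filter (2 ≤ ·)).sum + σ.parts.count 1 = N := by
  simpa [σ.parts_sum] using (congrArg Multiset.sum (parts_eq_filter_add_replicate σ)).symm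

lemma mem_conjClass_iff_cycleType_eq {g : Equiv.Perm (Fin N)} :
    g ∈ conjClass σ ↔ g.cycleType = σ.parts.filter (2 ≤ ·) := by
  simp only [conjClass, Finset.mem_filter_univ]
  refine ⟨fun h => by rw [← h, Equiv.Perm.filter_parts_partition_eq_cycleType], fun h => ?_⟩
  rw [parts_eq_filter_add_replicate σ, Equiv.Perm.parts_partition, ← Equiv.Perm.sum_cycleType, h,
    Fintype.card_fin, Nat.sub_eq_of_eq_add' (sum_filter_parts_add_count_one σ).symm]

lemma card_conjClass_mul_centralizerOrder :
    (conjClass σ).card * centralizerOrder σ.parts = N.factorial := by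
  have hclass : conjClass σ =
      ({g | g.cycleType = σ.parts.filter (2 ≤ ·)} : Finset (Equiv.Perm (Fin N))) := by
    ext g
    rw [mem_conjClass_iff_cycleType_eq, Finset.mem_filter_univ]
  have hfix := sum_filter_parts_add_count_one σ
  have hcard := Equiv.Perm.card_of_cycleType_mul_eq (Fin N) (σ.parts.filter (2 ≤ ·))
  rw [Fintype.card_fin, if_pos ⟨by omega, fun i hi => (Multiset.mem_filter.1 hi).2⟩,
    ← hclass, mul_assoc, ← centralizerOrder,
    Nat.sub_eq_of_eq_add' hfix.symm] at hcard
  rw [parts_eq_filter_add_replicate σ, centralizerOrder_add_replicate_one (by simp), hcard]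

end CycleType

section PartitionSum

lemma sum_count_mul_eq {N : ℕ} (σ : N.Partition) :
    ∑ i ∈ σ.parts.toFinset, i * σ.parts.count i = N := by
  conv_rhs => rw [← σ.parts_sum, Finset.sum_multiset_count]
  simp only [smul_eq_mul, mul_comm]

lemma sum_partition_sum_erase {B : Type*} [AddCommMonoid B] (N : ℕ) (f : ℕ → Multiset ℕ → B) :
    ∑ σ : N.Partition, ∑ i ∈ σ.parts.toFinset, f i (σ.parts.erase i) =
      ∑ i ∈ Finset.range N, ∑ τ : (N - (i + 1)).Partition, f (i + 1) τ.parts := by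
  have hmem (σ : N.Partition) (i : ℕ) :
      σ ∈ Finset.univ ∧ i ∈ σ.parts.toFinset ↔
        σ ∈ ({σ | i ∈ σ.parts} : Finset N.Partition) ∧ i ∈ Finset.Ico 1 (N + 1) := by
    simp only [Finset.mem_univ, true_and, Multiset.mem_toFinset, Finset.mem_filter_univ,
      Finset.mem_Ico, iff_self_and]
    exact fun hi => ⟨σ.parts_pos hi, Nat.lt_succ_of_le (σ.le_of_mem_parts hi)⟩
  rw [Finset.sum_comm' hmem, Finset.sum_Ico_eq_sum_range]
  refine Finset.sum_congr (by rw [Nat.add_sub_cancel]) fun i hi => ?_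
  rw [add_comm 1 i, Finset.sum_subtype _ fun σ => Finset.mem_filter_univ σ]
  exact Fintype.sum_equiv (Nat.Partition.partitionWithPartEquiv i.succ_pos (by
    simpa [Nat.succ_le_iff] using hi)) _ _ fun σ => by
    rw [Nat.Partition.partitionWithPartEquiv_apply_parts]

end PartitionSum

section Newton

variable (k : Type*) {A : Type*} [Field k] [CommRing A] [Algebra k A] (p : ℕ → A)

/-- The contribution of the cycle type `s` to the expansion of an elementary symmetric function in
terms of the power sums `p i`. -/
def cycleTerm (s : Multiset ℕ) : A :=
  ((centralizerOrder s : k)⁻¹ * (s.map fun i => -(-1 : k) ^ i).prod) • (s.map p).prod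

/-- The `N`-th elementary symmetric function in terms of the power sums `p i`. -/
def esymmSum (N : ℕ) : A := ∑ σ : N.Partition, cycleTerm k p σ.parts

lemma esymmSum_zero : esymmSum k p 0 = 1 := by
  simp [esymmSum, cycleTerm, centralizerOrder]

variable [CharZero k]

lemma cycleTerm_cons {i : ℕ} {s : Multiset ℕ} (hs : ∀ j ∈ i ::ₘ s, 0 < j) :
    ((i * (i ::ₘ s).count i : ℕ) : k) • cycleTerm k p (i ::ₘ s)
      = (-(-1 : k) ^ i) • (p i * cycleTerm k p s) := by
  rw [Multiset.forall_mem_cons] at hs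
  have h0 : (centralizerOrder s : k) ≠ 0 := Nat.cast_ne_zero.2 (centralizerOrder_pos hs.2).ne'
  have h1 : (i : k) ≠ 0 := Nat.cast_ne_zero.2 hs.1.ne'
  have h2 : (s.count i : k) + 1 ≠ 0 := Nat.cast_add_one_ne_zero _
  rw [cycleTerm, cycleTerm, centralizerOrder_cons, Multiset.map_cons, Multiset.map_cons,
    Multiset.prod_cons, Multiset.prod_cons, mul_smul_comm, smul_smul, smul_smul,
    Multiset.count_cons_self]
  congr 1
  push_cast
  field_simp

lemma natCast_smul_esymmSum_succ (N : ℕ) : ((N + 1 : ℕ) : k) • esymmSum k p (N + 1) =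
    ∑ i ∈ Finset.range (N + 1), (-1 : k) ^ i • (p (i + 1) * esymmSum k p (N - i)) := by
  have hterm (σ : (N + 1).Partition) : ((N + 1 : ℕ) : k) • cycleTerm k p σ.parts =
      ∑ i ∈ σ.parts.toFinset, (-(-1 : k) ^ i) • (p i * cycleTerm k p (σ.parts.erase i)) := by
    have hN : ((N + 1 : ℕ) : k) = ∑ i ∈ σ.parts.toFinset, ((i * σ.parts.count i : ℕ) : k) := by
      rw [← Nat.cast_sum, sum_count_mul_eq]
    rw [hN, Finset.sum_smul]
    refine Finset.sum_congr rfl fun i hi => ?_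
    have hcons := Multiset.cons_erase (Multiset.mem_toFinset.1 hi)
    rw [← cycleTerm_cons k p (by rw [hcons]; exact fun j => σ.parts_pos), hcons]
  rw [esymmSum, Finset.smul_sum, Finset.sum_congr rfl fun σ _ => hterm σ,
    sum_partition_sum_erase (N + 1) fun i s => (-(-1 : k) ^ i) • (p i * cycleTerm k p s)]
  refine Finset.sum_congr rfl fun i _ => ?_
  rw [← Finset.smul_sum, ← Finset.mul_sum, Nat.add_sub_add_right, pow_succ, mul_neg_one, neg_neg,
    esymmSum]

lemma factorial_smul_sum_range_esymmSum (N : ℕ) : (N.factorial : k) •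
    ∑ i ∈ Finset.range (N + 1), (-1 : k) ^ i • (p (1 + i) * esymmSum k p (N - i))
      = ((N + 1).factorial : k) • esymmSum k p (N + 1) := by
  simp only [add_comm 1, ← natCast_smul_esymmSum_succ]
  rw [smul_smul, ← Nat.cast_mul, mul_comm, Nat.factorial_succ]

lemma newtonSum_eq_sum (N j : ℕ) : newtonSum p N j = (N.factorial : k) •
    ∑ i ∈ Finset.range (N + 1), (-1 : k) ^ i • (p (j + i) * esymmSum k p (N - i)) := by
  induction N generalizing j with
  | zero => simp [newtonSum, esymmSum_zero]
  | succ N ih =>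
    have hshift : ∑ i ∈ Finset.range (N + 1),
        (-1 : k) ^ (i + 1) • (p (j + (i + 1)) * esymmSum k p (N + 1 - (i + 1))) =
        -∑ i ∈ Finset.range (N + 1), (-1 : k) ^ i • (p (j + 1 + i) * esymmSum k p (N - i)) := by
      simp only [← Finset.sum_neg_distrib, ← neg_smul, pow_succ, mul_neg_one,
        Nat.add_sub_add_right, add_assoc, add_comm 1]
    rw [newtonSum, ih, ih, factorial_smul_sum_range_esymmSum, Finset.sum_range_succ' _ (N + 1),
      hshift, Nat.factorial_succ, mul_comm (p _), pow_zero, one_smul, add_zero, tsub_zero,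
      smul_mul_assoc]
    push_cast
    module

include k in
lemma sum_conjClass_smul_prod (N : ℕ) :
    ∑ σ : (N + 1).Partition, (signPartition σ * ((conjClass σ).card : ℤ)) • (σ.parts.map p).prod
      = newtonSum p N 1 := by
  rw [newtonSum_eq_sum k, factorial_smul_sum_range_esymmSum, esymmSum, Finset.smul_sum]
  refine Finset.sum_congr rfl fun σ _ => ?_
  have h0 : (centralizerOrder σ.parts : k) ≠ 0 :=
    Nat.cast_ne_zero.2 (centralizerOrder_pos fun i hi => σ.parts_pos hi).ne'
  have hsign : ((signPartition σ : ℤ) : k) = (σ.parts.map fun i => -(-1 : k) ^ i).prod := by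
    simp [signPartition, Int.cast_multiset_prod]
  rw [cycleTerm, smul_smul, ← card_conjClass_mul_centralizerOrder σ, ← Int.cast_smul_eq_zsmul k]
  congr 1
  push_cast
  rw [hsign]
  field_simp

include k in
lemma sum_conjClass_smul_prod_sort {A : Type*} [Ring A] [Algebra k A] {p : ℕ → A}
    (hp : ∀ i j, Commute (p i) (p j)) (N : ℕ) :
    ∑ σ : (N + 1).Partition, (signPartition σ * ((conjClass σ).card : ℤ)) •
      ((σ.parts.sort (· ≥ ·)).map p).prod = newtonSum p N 1 := by
  let S := Algebra.adjoin k (Set.range p)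
  have hS : IsMulCommutative S := Algebra.isMulCommutative_adjoin k (by
    rintro _ ⟨i, rfl⟩ _ ⟨j, rfl⟩
    exact hp i j)
  let _ : CommRing S := { (inferInstance : Ring S) with mul_comm := hS.is_comm.comm }
  let q (i : ℕ) : S := ⟨p i, Algebra.subset_adjoin ⟨i, rfl⟩⟩
  have hnewton : S.val (newtonSum q N 1) = newtonSum p N 1 := map_newtonSum S.val.toRingHom q N 1
  rw [← hnewton, ← sum_conjClass_smul_prod k q, map_sum]
  refine Finset.sum_congr rfl fun σ _ => ?_
  conv_rhs => rw [← Multiset.sort_eq σ.parts (· ≥ ·)]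
  rw [map_zsmul, Multiset.map_coe, Multiset.prod_coe, map_list_prod, List.map_map]
  rfl

end Newton

/-! ## Powers in Jordan algebras -/

section Powers

variable (k : Type*) {J : Type*} [Field k] [CharZero k] [NonAssocCommRing J] [Module k J]
  [IsScalarTower k J J] [SMulCommClass k J J] [IsCommJordan J]

lemma mulLeft_mul_mul (a b c : J) : LinearMap.mulLeft k (a * b * c) =
    LinearMap.mulLeft k c * LinearMap.mulLeft k (a * b) +
      LinearMap.mulLeft k a * LinearMap.mulLeft k (b * c) +
      LinearMap.mulLeft k b * LinearMap.mulLeft k (c * a) -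
      LinearMap.mulLeft k a * LinearMap.mulLeft k c * LinearMap.mulLeft k b -
      LinearMap.mulLeft k b * LinearMap.mulLeft k c * LinearMap.mulLeft k a := by
  ext x
  have h1 := jordan_linear k a b x c
  have h2 := jordan_linear k a b c x
  simp only [Module.End.mul_apply, LinearMap.add_apply, LinearMap.sub_apply,
    LinearMap.mulLeft_apply]
  simp only [mul_comm] at h1 h2 ⊢
  linear_combination (norm := module) h2 - h1

variable {k} in
lemma commute_mulLeft_jpow_of_commute {a : J} {T : Module.End k J}
    (h₁ : Commute T (LinearMap.mulLeft k a)) (h₂ : Commute T (LinearMap.mulLeft k (a * a)))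
    (i : ℕ) : Commute T (LinearMap.mulLeft k (jpow a i)) := by
  induction i using Nat.twoStepInduction with
  | zero => rw [jpow, LinearMap.mulLeft_one]; exact Commute.one_right T
  | one => rwa [jpow, jpow, mul_one]
  | more i ih ih' =>
    rw [jpow, jpow, mul_comm a (a * _), mulLeft_mul_mul, mul_comm (jpow a i) a, ← jpow]
    exact ((((h₁.mul_right ih').add_right (h₁.mul_right ih')).add_right
      (ih.mul_right h₂)).sub_right ((h₁.mul_right h₁).mul_right ih)).sub_right
        ((ih.mul_right h₁).mul_right h₁)

include k in
lemma jpow_mul_jpow (a : J) (i j : ℕ) : jpow a i * jpow a j = jpow a (i + j) := by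
  induction j with
  | zero => exact mul_one _
  | succ j ih =>
    have hcomm := commute_mulLeft_jpow_of_commute (Commute.refl (LinearMap.mulLeft k a))
      (LinearMap.ext (jordan_identity a)) i
    calc jpow a i * (a * jpow a j) = a * (jpow a i * jpow a j) :=
          (LinearMap.congr_fun hcomm (jpow a j)).symm
      _ = jpow a (i + j + 1) := by rw [ih, jpow]

lemma brace_one_left (c : J) : brace k 1 c = 0 := by
  have h := brace_cyc k 1 1 c
  have s := brace_skew k c 1
  rw [mul_one, one_mul, mul_one] at h
  linear_combination (norm := module) s + s - h

lemma brace_jpow_succ_left (a : J) (i j : ℕ) : brace k (jpow a (i + 1)) (jpow a j) =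
    brace k (jpow a i) (jpow a (j + 1)) - brace k (jpow a (i + j)) a := by
  have h := brace_cyc k a (jpow a i) (jpow a j)
  rw [jpow_mul_jpow k, mul_comm (jpow a j) a, ← jpow, ← jpow, brace_skew k (jpow a i)] at h
  linear_combination (norm := module) h

lemma brace_jpow_succ_right (a : J) (i j : ℕ) :
    brace k (jpow a i) (jpow a (j + 1)) = -(i : k) • brace k (jpow a (i + j)) a := by
  induction i generalizing j with
  | zero => rw [jpow, brace_one_left, Nat.cast_zero, neg_zero, zero_smul]
  | succ i ih =>
    rw [brace_jpow_succ_left, ih, Nat.add_right_comm, add_assoc]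
    push_cast
    module

lemma brace_jpow_self (a : J) (i : ℕ) : brace k (jpow a i) a = 0 := by
  have h := brace_jpow_succ_right k a i 0
  rw [jpow, jpow, mul_one, add_zero] at h
  have h' : ((i : k) + 1) • brace k (jpow a i) a = 0 := by
    linear_combination (norm := module) h
  exact (smul_eq_zero.1 h').resolve_left (Nat.cast_add_one_ne_zero i)

lemma brace_jpow_jpow (a : J) (i j : ℕ) : brace k (jpow a i) (jpow a j) = 0 := by
  cases j with
  | zero => rw [jpow, brace_skew, brace_one_left, neg_zero]
  | succ j => rw [brace_jpow_succ_right, brace_jpow_self, smul_zero]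

end Powers

namespace JSpace

variable {k J M : Type*} [Field k] [NonAssocCommRing J] [Module k J]
  [IsScalarTower k J J] [SMulCommClass k J J] [AddCommGroup M] [Module k M]
  [CharZero k] [IsCommJordan J] (V : JSpace k J M)

lemma commute_ρ_jpow (a : J) (i j : ℕ) : Commute (V.ρ (jpow a i)) (V.ρ (jpow a j)) := by
  have h := V.braceAction_brace (jpow a i) (jpow a j)
  rw [brace_jpow_jpow, map_zero, eq_comm, smul_eq_zero] at h
  exact sub_eq_zero.1 (h.resolve_left (by norm_num))

lemma sum_conjClass_smul_ρPartition (N : ℕ) (a : J) :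
    ∑ σ : (N + 1).Partition, (signPartition σ * ((conjClass σ).card : ℤ)) • V.ρPartition σ a =
      newtonSum (fun i => V.ρ (jpow a i)) N 1 :=
  sum_conjClass_smul_prod_sort k (V.commute_ρ_jpow a) N

end JSpace

/-! ## The operators `e(a)`, `h(a)`, `f(a)` -/

namespace SL2J

variable {k J : Type*} [Field k] [NonAssocCommRing J] [Module k J]

/-- The inclusion of `{J,J}` into `sl₂(J)`. -/
def Z (z : JJ k J) : SL2J k J := ⟨0, 0, 0, z⟩

lemma eq_add (x : SL2J k J) : x = E k x.e + H k x.h + F k x.f + Z x.z := by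
  ext <;> simp [E, H, F, Z]

lemma E_add (a b : J) : E k (a + b) = E k a + E k b := by ext <;> simp [E]

lemma E_smul (r : k) (a : J) : E k (r • a) = r • E k a := by ext <;> simp [E]

lemma H_add (a b : J) : H k (a + b) = H k a + H k b := by ext <;> simp [H]

lemma H_smul (r : k) (a : J) : H k (r • a) = r • H k a := by ext <;> simp [H]

lemma F_add (a b : J) : F k (a + b) = F k a + F k b := by ext <;> simp [F]

lemma F_smul (r : k) (a : J) : F k (r • a) = r • F k a := by ext <;> simp [F]

variable [CharZero k] [IsScalarTower k J J] [SMulCommClass k J J] [IsCommJordan J]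

lemma lie_E_one_F (b : J) : ⁅E k (1 : J), F k b⁆ = H k b := by
  ext <;> simp [lie_e, lie_h, lie_f, lie_z, E, F, H, brace_one_left]

lemma lie_E_E (a b : J) : ⁅E k a, E k b⁆ = 0 := by
  ext <;> simp [lie_e, lie_h, lie_f, lie_z, E]

lemma lie_F_F (a b : J) : ⁅F k a, F k b⁆ = 0 := by
  ext <;> simp [lie_e, lie_h, lie_f, lie_z, F]

lemma lie_H_E (a b : J) : ⁅H k a, E k b⁆ = (2 : k) • E k (a * b) := by
  ext <;> simp [lie_e, lie_h, lie_f, lie_z, E, H]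

lemma lie_H_F (a b : J) : ⁅H k a, F k b⁆ = (-2 : k) • F k (a * b) := by
  ext <;> simp only [lie_e, lie_h, lie_f, lie_z, F, H, smul_e, smul_h, smul_f, smul_z] <;>
    simp [mul_comm]

lemma lie_H_H (a b : J) : ⁅H k a, H k b⁆ = (4 : k) • Z (brace k a b) := by
  ext <;> simp [lie_e, lie_h, lie_f, lie_z, H, Z]

end SL2J

section Operators

open SL2J

variable (k : Type*) {J : Type*} [Field k] [CharZero k] [NonAssocCommRing J] [Module k J]
  [IsScalarTower k J J] [SMulCommClass k J J] [IsCommJordan J]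
  (N : Type*) [AddCommGroup N] [Module k N] [LieRingModule (SL2J k J) N] [LieModule k (SL2J k J) N]

/-- The action of the elements `e(a)` on a module, as a linear map in `a`. -/
def opE : J →ₗ[k] Module.End k N :=
  LinearMap.mk₂ k (fun a v => ⁅E k a, v⁆) (fun a b v => by rw [E_add, add_lie])
    (fun r a v => by rw [E_smul, smul_lie]) (fun a => lie_add _) (fun r a => lie_smul r _)

/-- The action of the elements `h(a)` on a module, as a linear map in `a`. -/
def opH : J →ₗ[k] Module.End k N :=
  LinearMap.mk₂ k (fun a v => ⁅H k a, v⁆) (fun a b v => by rw [H_add, add_lie])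
    (fun r a v => by rw [H_smul, smul_lie]) (fun a => lie_add _) (fun r a => lie_smul r _)

/-- The action of the elements `f(a)` on a module, as a linear map in `a`. -/
def opF : J →ₗ[k] Module.End k N :=
  LinearMap.mk₂ k (fun a v => ⁅F k a, v⁆) (fun a b v => by rw [F_add, add_lie])
    (fun r a v => by rw [F_smul, smul_lie]) (fun a => lie_add _) (fun r a => lie_smul r _)

variable {N}

@[simp] lemma opE_apply (a : J) (v : N) : opE k N a v = ⁅E k a, v⁆ := rfl

@[simp] lemma opH_apply (a : J) (v : N) : opH k N a v = ⁅H k a, v⁆ := rfl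

@[simp] lemma opF_apply (a : J) (v : N) : opF k N a v = ⁅F k a, v⁆ := rfl

variable (N)

lemma commute_opE (a b : J) : Commute (opE k N a) (opE k N b) := LinearMap.ext fun v => by
  simp [leibniz_lie (E k a), lie_E_E]

lemma commute_opF (a b : J) : Commute (opF k N a) (opF k N b) := LinearMap.ext fun v => by
  simp [leibniz_lie (F k a), lie_F_F]

lemma opE_one_mul_opF (b : J) :
    opE k N (1 : J) * opF k N b = opF k N b * opE k N (1 : J) + opH k N b :=
  LinearMap.ext fun v => by
    simp [leibniz_lie (E k (1 : J)), lie_E_one_F, add_comm]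

lemma opH_mul_opE (b a : J) :
    opH k N b * opE k N a = opE k N a * opH k N b + 2 • opE k N (b * a) :=
  LinearMap.ext fun v => by
    simp [leibniz_lie (H k b), lie_H_E, ofNat_smul_eq_nsmul, add_comm]

lemma opH_mul_opF (b a : J) :
    opH k N b * opF k N a = opF k N a * opH k N b + 2 • -opF k N (b * a) :=
  LinearMap.ext fun v => by
    simp [leibniz_lie (H k b), lie_H_F, ofNat_smul_eq_nsmul, add_comm]

end Operators

/-! ## Highest weight maps -/

open SL2J

section Weights

variable {k J : Type*} [Field k] [CharZero k] [NonAssocCommRing J] [Module k J]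
  [IsScalarTower k J J] [SMulCommClass k J J] [IsCommJordan J]
  {N : Type*} [AddCommGroup N] [Module k N] [LieRingModule (SL2J k J) N] [LieModule k (SL2J k J) N]

lemma mem_weightSpace {j : ℤ} {v : N} :
    v ∈ weightSpace k J N j ↔ ⁅H k (1 : J), v⁆ = (j : k) • v := Iff.rfl

lemma E_mem_weightSpace (a : J) : E k a ∈ weightSpace k J (SL2J k J) 2 := by
  simp [mem_weightSpace, lie_H_E]

lemma F_mem_weightSpace (a : J) : F k a ∈ weightSpace k J (SL2J k J) (-2) := by
  simp [mem_weightSpace, lie_H_F]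

lemma lie_mem_weightSpace {i j : ℤ} {x : SL2J k J} {v : N}
    (hx : x ∈ weightSpace k J (SL2J k J) i) (hv : v ∈ weightSpace k J N j) :
    ⁅x, v⁆ ∈ weightSpace k J N (i + j) := by
  rw [mem_weightSpace] at hx hv ⊢
  rw [leibniz_lie, hx, hv, smul_lie, lie_smul, Int.cast_add, add_smul]

variable (k J N) in
lemma weightSpace_iSupIndep : iSupIndep (weightSpace k J N) :=
  (Module.End.eigenspaces_iSupIndep (LieModule.toEnd k (SL2J k J) N (H k (1 : J)))).comp
    (f := fun j : ℤ => (j : k)) Int.cast_injective |>.mono fun _ _ hv =>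
      Module.End.mem_eigenspace_iff.2 hv

lemma isBoundedOfLevel_iff {n : ℕ} : IsBoundedOfLevel k J N n ↔
    (⨆ j : Set.Icc (-(n : ℤ)) (n : ℤ), weightSpace k J N j) = ⊤ ∧ weightSpace k J N n ≠ ⊥ := by
  rw [IsBoundedOfLevel, DirectSum.isInternal_submodule_iff_iSupIndep_and_iSup_eq_top, and_assoc]
  exact and_iff_right ((weightSpace_iSupIndep k J N).comp Subtype.val_injective)

lemma IsBoundedOfLevel.weightSpace_eq_bot {n : ℕ} (h : IsBoundedOfLevel k J N n) {j : ℤ}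
    (hj : j ∉ Set.Icc (-(n : ℤ)) n) : weightSpace k J N j = ⊥ := by
  have htop : ⨆ i, ⨆ (_ : i ≠ j), weightSpace k J N i = ⊤ := by
    rw [eq_top_iff, ← (isBoundedOfLevel_iff.1 h).1]
    exact iSup_le fun i => le_iSup₂_of_le (i : ℤ) (ne_of_mem_of_not_mem i.2 hj) le_rfl
  simpa [htop] using weightSpace_iSupIndep k J N j

end Weights

section LeviAction

variable {k J M : Type*} [Field k] [CharZero k] [NonAssocCommRing J] [Module k J]
  [IsScalarTower k J J] [SMulCommClass k J J] [AddCommGroup M] [Module k M] (V : JSpace k J M)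

/-- The action of `𝔊₀` on a `J`-space, extended to a linear map on `sl₂(J)` by zero on `𝔊₁` and
`𝔊₋₁`. -/
def JSpace.leviAction : SL2J k J →ₗ[k] Module.End k M where
  toFun x := V.ρ x.h + V.braceAction x.z
  map_add' x y := by
    rw [SL2J.add_h, SL2J.add_z, map_add, map_add]
    abel
  map_smul' r x := by simp

lemma JSpace.leviAction_apply (x : SL2J k J) :
    V.leviAction x = V.ρ x.h + V.braceAction x.z := rfl

end LeviAction

section HighestWeightMaps

variable {k J M : Type*} [Field k] [CharZero k] [NonAssocCommRing J] [Module k J]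
  [IsScalarTower k J J] [SMulCommClass k J J] [IsCommJordan J] [AddCommGroup M] [Module k M]
  {N N' : Type*} [AddCommGroup N] [Module k N] [LieRingModule (SL2J k J) N]
  [AddCommGroup N'] [Module k N'] [LieRingModule (SL2J k J) N']

/-- A linear map from a `J`-space to a `𝔊`-module which is a homomorphism of
`𝔊₀ ⊕ 𝔊₁`-modules when `𝔊₁` acts on the `J`-space as zero. Since `4 {a,b} = [h(a), h(b)]`, nothing
needs to be required for `{J,J}`. -/
structure JSpace.IsHighestWeightMap (V : JSpace k J M) (g : M →ₗ[k] N) : Prop where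
  lie_E : ∀ (a : J) (m : M), ⁅E k a, g m⁆ = 0
  lie_H : ∀ (a : J) (m : M), ⁅H k a, g m⁆ = g (V.ρ a m)

namespace JSpace.IsHighestWeightMap

variable {V : JSpace k J M} {g : M →ₗ[k] N}

lemma comp (hg : V.IsHighestWeightMap g) (Φ : N →ₗ⁅k,SL2J k J⁆ N') :
    V.IsHighestWeightMap ((Φ : N →ₗ[k] N') ∘ₗ g) where
  lie_E a m := by simp [← LieModuleHom.map_lie, hg.lie_E]
  lie_H a m := by simp [← LieModuleHom.map_lie, hg.lie_H]

variable [LieModule k (SL2J k J) N]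

lemma lie_Z (hg : V.IsHighestWeightMap g) (z : JJ k J) (m : M) :
    ⁅(Z z : SL2J k J), g m⁆ = g (V.braceAction z m) := by
  induction z using JJ.induction with
  | zero => simp [show (Z 0 : SL2J k J) = 0 from rfl]
  | add x y hx hy =>
    have hadd : (Z (x + y) : SL2J k J) = Z x + Z y := by ext <;> simp [Z]
    rw [hadd, add_lie, hx, hy, map_add, LinearMap.add_apply, map_add]
  | brace a b =>
    have hZ : (Z (brace k a b) : SL2J k J) = (4 : k)⁻¹ • ⁅H k a, H k b⁆ := by
      rw [lie_H_H, smul_smul, inv_mul_cancel₀ (by norm_num), one_smul]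
    simp [hZ, hg.lie_H]

lemma lie_of_f_eq_zero (hg : V.IsHighestWeightMap g) {x : SL2J k J} (hx : x.f = 0) (m : M) :
    ⁅x, g m⁆ = g (V.leviAction x m) := by
  have hF : F k (0 : J) = 0 := rfl
  rw [eq_add x, add_lie, add_lie, add_lie, hx, hF, hg.lie_E, hg.lie_H, hg.lie_Z, zero_lie]
  simp [leviAction_apply, E, H, Z]

end JSpace.IsHighestWeightMap

end HighestWeightMaps

section LowerPieces

variable {k : Type*} (J : Type*) {M : Type*} [Field k] [CharZero k] [NonAssocCommRing J]
  [Module k J] [IsScalarTower k J J] [SMulCommClass k J J] [IsCommJordan J] [AddCommGroup M]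
  [Module k M] {N N' : Type*} [AddCommGroup N] [Module k N] [LieRingModule (SL2J k J) N]
  [LieModule k (SL2J k J) N] [AddCommGroup N'] [Module k N'] [LieRingModule (SL2J k J) N']
  [LieModule k (SL2J k J) N']

/-- The span of all `f(a₁) ⋯ f(aᵣ) g(m)`, for a linear map `g` from `M` to a `𝔊`-module. -/
def lowerPiece (g : M →ₗ[k] N) : ℕ → Submodule k N
  | 0 => LinearMap.range g
  | r + 1 => Submodule.map₂ (opF (J := J) k N) ⊤ (lowerPiece g r)

variable {J} {g : M →ₗ[k] N}

lemma lie_F_mem_lowerPiece {r : ℕ} {v : N} (hv : v ∈ lowerPiece J g r) (a : J) :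
    ⁅F k a, v⁆ ∈ lowerPiece J g (r + 1) :=
  Submodule.apply_mem_map₂ (opF k N) (Submodule.mem_top (x := a)) hv

lemma lowerPiece_succ_le {r : ℕ} {W : Submodule k N} :
    lowerPiece J g (r + 1) ≤ W ↔ ∀ (a : J), ∀ v ∈ lowerPiece J g r, ⁅F k a, v⁆ ∈ W := by
  simp [lowerPiece, Submodule.map₂_le]

lemma map_lowerPiece (Φ : N →ₗ⁅k,SL2J k J⁆ N') (g : M →ₗ[k] N) (r : ℕ) :
    (lowerPiece J g r).map (Φ : N →ₗ[k] N') = lowerPiece J ((Φ : N →ₗ[k] N') ∘ₗ g) r := by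
  induction r with
  | zero => exact (LinearMap.range_comp _ _).symm
  | succ r ih =>
    rw [lowerPiece, lowerPiece, Submodule.map_map₂, ← ih, Submodule.map₂_map_right]
    congr 1
    ext a v
    exact Φ.map_lie _ _

lemma lowerPiece_le_of_forall_pow {r : ℕ} {W : Submodule k N}
    (h : ∀ (a : J) (m : M), (opF k N a ^ r) (g m) ∈ W) : lowerPiece J g r ≤ W := by
  induction r generalizing W with
  | zero =>
    rintro _ ⟨m, rfl⟩
    exact h 0 m
  | succ r ih =>
    refine lowerPiece_succ_le.2 fun c v hv => ?_
    exact ih (W := W.comap (opF k N c)) (fun a m =>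
      apply_pow_apply_mem_of_forall_pow_succ_mem (commute_opF k N) (fun a => h a m) a c) hv

end LowerPieces

section HighestWeightMaps

variable {k J M : Type*} [Field k] [CharZero k] [NonAssocCommRing J] [Module k J]
  [IsScalarTower k J J] [SMulCommClass k J J] [IsCommJordan J] [AddCommGroup M] [Module k M]
  {N : Type*} [AddCommGroup N] [Module k N] [LieRingModule (SL2J k J) N] [LieModule k (SL2J k J) N]

namespace JSpace.IsHighestWeightMap

variable {V : JSpace k J M} {g : M →ₗ[k] N}

lemma lie_mem_lowerPiece (hg : V.IsHighestWeightMap g) {x : SL2J k J} (he : x.e = 0)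
    (hf : x.f = 0) {r : ℕ} {v : N} (hv : v ∈ lowerPiece J g r) : ⁅x, v⁆ ∈ lowerPiece J g r := by
  suffices hle : lowerPiece J g r ≤ (lowerPiece J g r).comap (LieModule.toEnd k (SL2J k J) N x) from
    hle hv
  clear hv
  induction r with
  | zero =>
    rintro _ ⟨m, rfl⟩
    exact ⟨_, (hg.lie_of_f_eq_zero hf m).symm⟩
  | succ r ih =>
    refine lowerPiece_succ_le.2 fun a v hv => ?_
    have hxF : ⁅x, F k a⁆ = F k ⁅x, F k a⁆.f := by
      ext <;> simp [lie_e, lie_h, lie_z, lie_f, F, he, hf]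
    rw [Submodule.mem_comap, LieModule.toEnd_apply_apply, leibniz_lie, hxF]
    exact add_mem (lie_F_mem_lowerPiece hv _) (lie_F_mem_lowerPiece (ih hv) a)

lemma lie_E_eq_zero_of_mem (hg : V.IsHighestWeightMap g) {v : N} (hv : v ∈ lowerPiece J g 0)
    (a : J) : ⁅E k a, v⁆ = 0 := by
  obtain ⟨m, rfl⟩ := hv
  exact hg.lie_E a m

lemma lie_E_mem_lowerPiece (hg : V.IsHighestWeightMap g) {r : ℕ} {v : N}
    (hv : v ∈ lowerPiece J g (r + 1)) (a : J) : ⁅E k a, v⁆ ∈ lowerPiece J g r := by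
  have of_mem {r : ℕ}
      (h : ∀ b : J, ∀ v ∈ lowerPiece J g r, ⁅F k b, ⁅E k a, v⁆⁆ ∈ lowerPiece J g r) :
      lowerPiece J g (r + 1) ≤ (lowerPiece J g r).comap (opE k N a) := by
    refine lowerPiece_succ_le.2 fun b v hv => ?_
    rw [Submodule.mem_comap, opE_apply, leibniz_lie]
    exact add_mem (hg.lie_mem_lowerPiece (by simp [lie_e, E, F]) (by simp [lie_f, E, F]) hv)
      (h b v hv)
  suffices hle : lowerPiece J g (r + 1) ≤ (lowerPiece J g r).comap (opE k N a) from hle hv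
  clear hv
  induction r with
  | zero => exact of_mem fun b v hv => by simp [hg.lie_E_eq_zero_of_mem hv]
  | succ r ih => exact of_mem fun b v hv => lie_F_mem_lowerPiece (ih hv) b

lemma opE_pow_eq_zero_of_mem (hg : V.IsHighestWeightMap g) {r : ℕ} {v : N}
    (hv : v ∈ lowerPiece J g r) (a : J) : (opE k N a ^ (r + 1)) v = 0 := by
  induction r generalizing v with
  | zero => simpa using hg.lie_E_eq_zero_of_mem hv a
  | succ r ih =>
    rw [pow_succ, Module.End.mul_apply]
    exact ih (hg.lie_E_mem_lowerPiece hv a)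

/-- The submodule generated by the image of a highest weight map. -/
def lowerSubmodule (hg : V.IsHighestWeightMap g) : LieSubmodule k (SL2J k J) N where
  __ := ⨆ r, lowerPiece J g r
  lie_mem {x v} hv := by
    have mem_iSup {r : ℕ} {w : N} (hw : w ∈ lowerPiece J g r) : w ∈ ⨆ r, lowerPiece J g r :=
      Submodule.mem_iSup_of_mem r hw
    refine Submodule.iSup_induction _ (motive := fun v => ⁅x, v⁆ ∈ ⨆ r, lowerPiece J g r) hv
      (fun r v hv => ?_) (by simp) (fun v w hv hw => by rw [lie_add]; exact add_mem hv hw)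
    rw [eq_add x, add_lie, add_lie, add_lie]
    refine add_mem (add_mem (add_mem ?_ (mem_iSup (hg.lie_mem_lowerPiece rfl rfl hv)))
      (mem_iSup (lie_F_mem_lowerPiece hv _))) (mem_iSup (hg.lie_mem_lowerPiece rfl rfl hv))
    cases r with
    | zero => rw [hg.lie_E_eq_zero_of_mem hv]; exact zero_mem _
    | succ r => exact mem_iSup (hg.lie_E_mem_lowerPiece hv _)

end JSpace.IsHighestWeightMap

end HighestWeightMaps

section HighestWeightMaps

variable {k J M : Type*} [Field k] [CharZero k] [NonAssocCommRing J] [Module k J]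
  [IsScalarTower k J J] [SMulCommClass k J J] [IsCommJordan J] [AddCommGroup M] [Module k M]
  {N : Type*} [AddCommGroup N] [Module k N] [LieRingModule (SL2J k J) N] [LieModule k (SL2J k J) N]

lemma opF_pow_succ_apply (a : J) (r : ℕ) (v : N) :
    (opF k N a ^ (r + 1)) v = opF k N (jpow a 1) ((opF k N a ^ r) v) := by
  rw [jpow, jpow, mul_one, pow_succ', Module.End.mul_apply]

lemma opF_pow_apply_mem_lowerPiece (g : M →ₗ[k] N) (a : J) (m : M) (r : ℕ) :
    (opF k N a ^ r) (g m) ∈ lowerPiece J g r := by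
  induction r with
  | zero => exact ⟨m, rfl⟩
  | succ r ih =>
    rw [pow_succ', Module.End.mul_apply]
    exact lie_F_mem_lowerPiece ih a

lemma lowerPiece_eq_bot_of_le {g : M →ₗ[k] N} {r s : ℕ} (hrs : r ≤ s)
    (h : lowerPiece J g r = ⊥) : lowerPiece J g s = ⊥ := by
  induction s, hrs using Nat.le_induction with
  | base => exact h
  | succ s _ ih => rw [lowerPiece, ih, Submodule.map₂_bot_right]

namespace JSpace.IsHighestWeightMap

variable {V : JSpace k J M} {g : M →ₗ[k] N} {n : ℕ}

lemma lowerPiece_le_weightSpace (hg : V.IsHighestWeightMap g) (hn : V.IsOfLevel n) (r : ℕ) :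
    lowerPiece J g r ≤ weightSpace k J N (n - 2 * r) := by
  induction r with
  | zero =>
    rintro _ ⟨m, rfl⟩
    have hn : V.ρ 1 = (n : k) • (1 : Module.End k M) := hn
    simp [mem_weightSpace, hg.lie_H, hn]
  | succ r ih =>
    refine lowerPiece_succ_le.2 fun a v hv => ?_
    convert lie_mem_weightSpace (F_mem_weightSpace a) (ih hv) using 2
    push_cast
    ring

lemma range_le_weightSpace (hg : V.IsHighestWeightMap g) (hn : V.IsOfLevel n) :
    LinearMap.range g ≤ weightSpace k J N n := by
  simpa using! hg.lowerPiece_le_weightSpace hn 0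

lemma range_eq_weightSpace (hg : V.IsHighestWeightMap g) (hn : V.IsOfLevel n)
    (hgen : ⨆ r, lowerPiece J g r = ⊤) : LinearMap.range g = weightSpace k J N n := by
  refine (hg.range_le_weightSpace hn).antisymm fun w hw => ?_
  have hlower : ⨆ r, lowerPiece J g (r + 1) ≤ ⨆ j, ⨆ (_ : j ≠ (n : ℤ)), weightSpace k J N j :=
    iSup_le fun r => le_iSup₂_of_le _ (by omega) (hg.lowerPiece_le_weightSpace hn (r + 1))
  have hw' : w ∈ LinearMap.range g ⊔ ⨆ r, lowerPiece J g (r + 1) := by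
    rw [show LinearMap.range g = lowerPiece J g 0 from rfl, sup_iSup_nat_succ, hgen]
    trivial
  obtain ⟨u, hu, v, hv, rfl⟩ := Submodule.mem_sup.1 hw'
  have hvn : v ∈ weightSpace k J N n :=
    (Submodule.add_mem_iff_right _ (hg.range_le_weightSpace hn hu)).1 hw
  rwa [Submodule.disjoint_def.1 (weightSpace_iSupIndep k J N n) v hvn (hlower hv), add_zero]

lemma isBoundedOfLevel [Nontrivial M] (hg : V.IsHighestWeightMap g) (hn : V.IsOfLevel n)
    (hgen : ⨆ r, lowerPiece J g r = ⊤) (hinj : Function.Injective g)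
    (hbot : lowerPiece J g (n + 1) = ⊥) : IsBoundedOfLevel k J N n := by
  refine isBoundedOfLevel_iff.2 ⟨?_, fun hn_bot => ?_⟩
  · rw [eq_top_iff, ← hgen]
    refine iSup_le fun r => ?_
    rcases le_or_gt r n with hr | hr
    · exact (hg.lowerPiece_le_weightSpace hn r).trans
        (le_iSup (fun j : Set.Icc (-(n : ℤ)) (n : ℤ) => weightSpace k J N j)
          ⟨n - 2 * r, by constructor <;> omega⟩)
    · rw [lowerPiece_eq_bot_of_le hr hbot]
      exact bot_le
  · obtain ⟨m, hm⟩ := exists_ne (0 : M)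
    have hgm : g m ∈ weightSpace k J N n := hg.range_le_weightSpace hn ⟨m, rfl⟩
    rw [hn_bot, Submodule.mem_bot, map_eq_zero_iff g hinj] at hgm
    exact hm hgm

lemma lowerPiece_eq_bot (hg : V.IsHighestWeightMap g) (hn : V.IsOfLevel n)
    (hN : IsBoundedOfLevel k J N n) : lowerPiece J g (n + 1) = ⊥ := by
  rw [← le_bot_iff, ← hN.weightSpace_eq_bot (j := n - 2 * (n + 1 : ℕ)) (by simp; omega)]
  exact hg.lowerPiece_le_weightSpace hn (n + 1)

lemma opH_opF_pow_succ (hg : V.IsHighestWeightMap g) (a b : J) (m : M) (r : ℕ) :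
    opH k N b ((opF k N a ^ (r + 1)) (g m)) = (opF k N a ^ (r + 1)) (g (V.ρ b m)) -
      (2 * (r + 1)) • opF k N (b * a) ((opF k N a ^ r) (g m)) := by
  have h := LinearMap.congr_fun (mul_pow_succ_of_mul_eq_add (opH_mul_opF k N b a)
    (commute_opF k N a (b * a)).neg_right r) (g m)
  simp only [Module.End.mul_apply, LinearMap.add_apply, LinearMap.smul_apply, neg_mul,
    LinearMap.neg_apply, smul_neg] at h
  rw [h, opH_apply, hg.lie_H, sub_eq_add_neg]

lemma opE_one_pow_opF_opF_pow (hg : V.IsHighestWeightMap g) (a : J) (m : M) (r j : ℕ) :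
    (opE k N (1 : J) ^ (r + 1)) (opF k N (jpow a j) ((opF k N a ^ r) (g m))) =
      (r + 1).factorial • g (newtonSum (fun i => V.ρ (jpow a i)) r j m) := by
  induction r generalizing m j with
  | zero => simp [leibniz_lie (E k (1 : J)), lie_E_one_F, hg.lie_E, hg.lie_H, newtonSum]
  | succ r ih =>
    set v := (opF k N a ^ (r + 1)) (g m) with hv
    have hkill : (opE k N (1 : J) ^ (r + 1 + 1)) v = 0 :=
      hg.opE_pow_eq_zero_of_mem (opF_pow_apply_mem_lowerPiece g a m (r + 1)) 1
    have hE (m : M) : (opE k N (1 : J) ^ (r + 1)) ((opF k N a ^ (r + 1)) (g m)) =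
        (r + 1).factorial • g (newtonSum (fun i => V.ρ (jpow a i)) r 1 m) := by
      rw [opF_pow_succ_apply, ih]
    have hEH : (opE k N (1 : J) ^ (r + 1)) (opH k N (jpow a j) v) = (r + 1).factorial •
        (g (newtonSum (fun i => V.ρ (jpow a i)) r 1 (V.ρ (jpow a j) m)) -
          (2 * (r + 1)) • g (newtonSum (fun i => V.ρ (jpow a i)) r (j + 1) m)) := by
      rw [hv, hg.opH_opF_pow_succ, map_sub, hE, map_nsmul,
        show jpow a j * a = jpow a (j + 1) from mul_comm _ _, ih, smul_sub, smul_comm]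
    have hcomm : V.ρ (jpow a j) (newtonSum (fun i => V.ρ (jpow a i)) r 1 m) =
        newtonSum (fun i => V.ρ (jpow a i)) r 1 (V.ρ (jpow a j) m) :=
      LinearMap.congr_fun (commute_newtonSum (fun i => V.commute_ρ_jpow a j i) r 1).eq m
    have htwo : 2 • (opE k N (1 : J) ^ (r + 1 + 1)) (opF k N (jpow a j) v) =
        2 • opF k N (jpow a j) ((opE k N (1 : J) ^ (r + 1 + 1)) v) +
          (r + 1 + 1) • ((opE k N (1 : J) ^ (r + 1)) (opH k N (jpow a j) v) +
            opH k N (jpow a j) ((opE k N (1 : J) ^ (r + 1)) v)) :=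
      LinearMap.congr_fun (two_nsmul_pow_succ_mul (opE_one_mul_opF k N (jpow a j))
        (opH_mul_opE k N (jpow a j) 1) (commute_opE k N 1 _) (r + 1)) v
    rw [hkill, map_zero, hEH, hv, hE, map_nsmul, opH_apply, hg.lie_H, hcomm] at htwo
    refine smul_right_injective N (two_ne_zero (α := k)) ?_
    rw [newtonSum, Nat.factorial_succ (r + 1), LinearMap.sub_apply, LinearMap.smul_apply, map_sub,
      Module.End.mul_apply, map_nsmul]
    linear_combination (norm := module) htwo

lemma opE_one_pow_opF_pow (hg : V.IsHighestWeightMap g) (a : J) (m : M) (r : ℕ) :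
    (opE k N (1 : J) ^ (r + 1)) ((opF k N a ^ (r + 1)) (g m)) =
      (r + 1).factorial • g (newtonSum (fun i => V.ρ (jpow a i)) r 1 m) := by
  rw [opF_pow_succ_apply, hg.opE_one_pow_opF_opF_pow]

end JSpace.IsHighestWeightMap

end HighestWeightMaps

section RaisingKernels

variable (k J : Type*) [Field k] [CharZero k] [NonAssocCommRing J] [Module k J]
  [IsScalarTower k J J] [SMulCommClass k J J] [IsCommJordan J]
  (N : Type*) [AddCommGroup N] [Module k N] [LieRingModule (SL2J k J) N] [LieModule k (SL2J k J) N]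

/-- The vectors of a `𝔊`-module killed by all products `e(b₁) ⋯ e(bⱼ)`. -/
def raisingKer : ℕ → Submodule k N
  | 0 => ⊥
  | j + 1 => ⨅ b : J, (raisingKer j).comap (opE k N b)

variable {k J N}

lemma mem_raisingKer_succ {j : ℕ} {v : N} :
    v ∈ raisingKer k J N (j + 1) ↔ ∀ b : J, ⁅E k b, v⁆ ∈ raisingKer k J N j := by
  simp [raisingKer]

lemma lie_H_mem_raisingKer {j : ℕ} {v : N} (hv : v ∈ raisingKer k J N j) (c : J) :
    ⁅H k c, v⁆ ∈ raisingKer k J N j := by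
  induction j generalizing v with
  | zero => simp [(Submodule.mem_bot k).1 hv]
  | succ j ih =>
    rw [mem_raisingKer_succ] at hv ⊢
    intro b
    rw [leibniz_lie, ← lie_skew, lie_H_E, neg_lie, smul_lie]
    exact add_mem (neg_mem (Submodule.smul_mem _ _ (hv _))) (ih (hv b))

-- `[h(b), e(1) ^ (s + 1)] = 2 (s + 1) e(b) e(1) ^ s` trades each factor `e(1)` for an `e(b)`.
lemma opE_one_pow_apply_mem_raisingKer {W : Submodule k N}
    (hW : ∀ c : J, ∀ v ∈ W, ⁅H k c, v⁆ ∈ W) {j s : ℕ}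
    (hkill : ∀ v ∈ W, (opE k N (1 : J) ^ (j + s)) v = 0) {v : N} (hv : v ∈ W) :
    (opE k N (1 : J) ^ s) v ∈ raisingKer k J N j := by
  induction j generalizing s v with
  | zero => simpa [raisingKer] using hkill v hv
  | succ j ih =>
    have hmem {w : N} (hw : w ∈ W) : (opE k N (1 : J) ^ (s + 1)) w ∈ raisingKer k J N j :=
      ih (fun u hu => by rw [← add_assoc, add_right_comm]; exact hkill u hu) hw
    refine mem_raisingKer_succ.2 fun b => ?_
    have hcomm : opH k N b ((opE k N (1 : J) ^ (s + 1)) v) =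
        (opE k N (1 : J) ^ (s + 1)) (opH k N b v) +
          (2 * (s + 1)) • opE k N (b * 1) ((opE k N (1 : J) ^ s) v) :=
      LinearMap.congr_fun
        (mul_pow_succ_of_mul_eq_add (opH_mul_opE k N b 1) (commute_opE k N 1 (b * 1)) s) v
    have hsmul : ((2 * (s + 1) : ℕ) : k) • ⁅E k b, (opE k N (1 : J) ^ s) v⁆ ∈
        raisingKer k J N j := by
      rw [Nat.cast_smul_eq_nsmul, ← opE_apply, ← mul_one b, ← sub_eq_of_eq_add' hcomm]
      exact sub_mem (lie_H_mem_raisingKer (hmem hv) b) (hmem (hW b v hv))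
    exact (Submodule.smul_mem_iff _ (Nat.cast_ne_zero.2 (by simp))).1 hsmul

end RaisingKernels

/-! ## The coinduced module -/

section CoinducedModule

variable {k J M : Type*} [Field k] [NonAssocCommRing J] [Module k J] [AddCommGroup M] [Module k M]

variable (k) in
/-- The symmetric multilinear functions of finitely many elements of `J`. -/
structure IsSymmMultilinear (φ : List J → M) : Prop where
  map_add : ∀ L₁ L₂ a b, φ (L₁ ++ (a + b) :: L₂) = φ (L₁ ++ a :: L₂) + φ (L₁ ++ b :: L₂)
  map_smul : ∀ L₁ L₂ (r : k) a, φ (L₁ ++ (r • a) :: L₂) = r • φ (L₁ ++ a :: L₂)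
  map_swap : ∀ L₁ L₂ a b, φ (L₁ ++ a :: b :: L₂) = φ (L₁ ++ b :: a :: L₂)

lemma IsSymmMultilinear.cons {φ : List J → M} (hφ : IsSymmMultilinear k φ) (a : J) :
    IsSymmMultilinear k fun L => φ (a :: L) :=
  ⟨fun L₁ => hφ.map_add (a :: L₁), fun L₁ => hφ.map_smul (a :: L₁),
    fun L₁ => hφ.map_swap (a :: L₁)⟩

variable (k J M) in
/-- The space of symmetric multilinear functions with values in `M`. -/
def symmFun : Submodule k (List J → M) where
  carrier := {φ | IsSymmMultilinear k φ}
  add_mem' {φ ψ} hφ hψ :=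
    ⟨fun L₁ L₂ a b => by simp only [Pi.add_apply, hφ.map_add, hψ.map_add]; abel,
      fun L₁ L₂ r a => by simp only [Pi.add_apply, hφ.map_smul, hψ.map_smul, smul_add],
      fun L₁ L₂ a b => congrArg₂ (· + ·) (hφ.map_swap L₁ L₂ a b) (hψ.map_swap L₁ L₂ a b)⟩
  zero_mem' := ⟨by simp, by simp, by simp⟩
  smul_mem' r φ hφ :=
    ⟨fun L₁ L₂ a b => by simp only [Pi.smul_apply, hφ.map_add, smul_add],
      fun L₁ L₂ s a => by simp only [Pi.smul_apply, hφ.map_smul, smul_comm r s],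
      fun L₁ L₂ a b => congrArg (r • ·) (hφ.map_swap L₁ L₂ a b)⟩

namespace JSpace

variable [IsScalarTower k J J] [SMulCommClass k J J] (V : JSpace k J M)

/-- The module coinduced from the `𝔊₋₁ ⊕ 𝔊₀`-module `M` on which `𝔊₋₁` acts as zero. Its elements
are encoded as symmetric multilinear functions, which makes the Poincaré–Birkhoff–Witt theorem
unnecessary. -/
def Coinduced (_ : JSpace k J M) : Type _ := symmFun k J M

instance : AddCommGroup V.Coinduced := inferInstanceAs (AddCommGroup (symmFun k J M))

instance : Module k V.Coinduced := inferInstanceAs (Module k (symmFun k J M))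

namespace Coinduced

variable {V}

/-- The symmetric multilinear function underlying an element of the coinduced module. -/
def eval : V.Coinduced →ₗ[k] List J → M := (symmFun k J M).subtype

@[ext] lemma ext {φ ψ : V.Coinduced} (h : ∀ L, eval φ L = eval ψ L) : φ = ψ :=
  Subtype.ext (funext h)

lemma isSymmMultilinear_eval (φ : V.Coinduced) : IsSymmMultilinear k (eval φ) := φ.2

variable (V) in
/-- The embedding of `M` into the coinduced module. -/
def const : M →ₗ[k] V.Coinduced where
  toFun m := ⟨fun L => if L = [] then m else 0, by simp, by simp, by simp⟩
  map_add' m m' := by ext (_ | _); exacts [rfl, (add_zero 0).symm]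
  map_smul' r m := by ext (_ | _); exacts [rfl, (smul_zero r).symm]

@[simp] lemma eval_const_nil (m : M) : eval (const V m) [] = m := rfl

@[simp] lemma eval_const_cons (m : M) (a : J) (L : List J) : eval (const V m) (a :: L) = 0 := rfl

lemma const_injective : Function.Injective (const V) := fun m m' h => by
  rw [← eval_const_nil (V := V) m, h, eval_const_nil]

end Coinduced

variable [CharZero k] [IsCommJordan J] {φ : List J → M}

/-- The action of `sl₂(J)` on the functions `List J → M`, where `φ [x₁, …, xᵣ]` stands for the value
at `1` of `e(xᵣ) ⋯ e(x₁) φ` in the module coinduced from `𝔊₋₁ ⊕ 𝔊₀` to `𝔊`. -/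
def coact : List J → SL2J k J → (List J → M) → M
  | [], x, φ => V.leviAction x (φ []) + φ [x.e]
  | a :: L, x, φ => coact L x (fun L => φ (a :: L)) + coact L ⁅E k a, x⁆ φ

@[simp] lemma coact_nil (x : SL2J k J) (φ : List J → M) :
    V.coact [] x φ = V.leviAction x (φ []) + φ [x.e] := rfl

@[simp] lemma coact_cons (a : J) (L : List J) (x : SL2J k J) (φ : List J → M) :
    V.coact (a :: L) x φ = V.coact L x (fun L => φ (a :: L)) + V.coact L ⁅E k a, x⁆ φ := rfl

lemma coact_add (L : List J) (x : SL2J k J) (φ ψ : List J → M) :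
    V.coact L x (φ + ψ) = V.coact L x φ + V.coact L x ψ := by
  induction L generalizing x φ ψ with
  | nil => simp only [coact_nil, Pi.add_apply, map_add]; abel
  | cons a L ih =>
    have hcons : (fun L => (φ + ψ) (a :: L)) = (fun L => φ (a :: L)) + fun L => ψ (a :: L) := rfl
    rw [coact_cons, coact_cons, coact_cons, hcons, ih, ih]
    abel

lemma coact_smul (L : List J) (x : SL2J k J) (r : k) (φ : List J → M) :
    V.coact L x (r • φ) = r • V.coact L x φ := by
  induction L generalizing x φ with
  | nil => simp only [coact_nil, Pi.smul_apply, map_smul, smul_add]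
  | cons a L ih =>
    have hcons : (fun L => (r • φ) (a :: L)) = r • fun L => φ (a :: L) := rfl
    rw [coact_cons, coact_cons, hcons, ih, ih, smul_add]

lemma leviAction_lie (x y : SL2J k J) :
    V.leviAction ⁅x, y⁆ = V.leviAction x * V.leviAction y - V.leviAction y * V.leviAction x
      + V.leviAction ⁅E k x.e, y⁆ - V.leviAction ⁅E k y.e, x⁆ := by
  have hzh := V.braceAction_lie_ρ x.z y.h
  have hhz := V.braceAction_lie_ρ y.z x.h
  have hzz := V.braceAction_lie x.z y.z
  have hhh : (4 : k) • V.braceAction (brace k x.h y.h) = V.ρ x.h * V.ρ y.h - V.ρ y.h * V.ρ x.h := by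
    rw [braceAction_brace, smul_smul, mul_inv_cancel₀ (by norm_num), one_smul]
  simp only [leviAction_apply, SL2J.lie_h, SL2J.lie_z, map_add, map_sub, map_smul, E, zero_mul,
    map_zero, LinearMap.zero_apply, smul_zero, sub_zero, add_zero, zero_add, ← hzh, ← hhz,
    ← hzz, hhh, add_mul, mul_add, brace_skew k y.e x.f, mul_comm y.e x.f, smul_add, map_neg,
    smul_neg]
  abel

lemma coact_add_left (hφ : IsSymmMultilinear k φ) (L : List J) (x y : SL2J k J) :
    V.coact L (x + y) φ = V.coact L x φ + V.coact L y φ := by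
  induction L generalizing x y φ with
  | nil =>
    have hadd : φ [x.e + y.e] = φ [x.e] + φ [y.e] := hφ.map_add [] [] x.e y.e
    simp only [coact_nil, map_add, LinearMap.add_apply, add_e, hadd]
    abel
  | cons a L ih =>
    simp only [coact_cons, lie_add]
    rw [ih hφ, ih (hφ.cons a)]
    abel

lemma coact_smul_left (hφ : IsSymmMultilinear k φ) (L : List J) (r : k) (x : SL2J k J) :
    V.coact L (r • x) φ = r • V.coact L x φ := by
  induction L generalizing x φ with
  | nil =>
    have hsmul : φ [r • x.e] = r • φ [x.e] := hφ.map_smul [] [] r x.e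
    simp only [coact_nil, map_smul, LinearMap.smul_apply, smul_e, hsmul, smul_add]
  | cons a L ih =>
    simp only [coact_cons, lie_smul]
    rw [ih hφ, ih (hφ.cons a), smul_add]

lemma isSymmMultilinear_coact (hφ : IsSymmMultilinear k φ) (x : SL2J k J) :
    IsSymmMultilinear k fun L => V.coact L x φ where
  map_add L₁ L₂ a b := by
    induction L₁ generalizing x φ with
    | nil =>
      have hadd : (fun L => φ ((a + b) :: L)) = (fun L => φ (a :: L)) + fun L => φ (b :: L) :=
        funext fun L => hφ.map_add [] L a b
      simp only [List.nil_append, coact_cons, E_add, add_lie, V.coact_add_left hφ, hadd, coact_add]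
      abel
    | cons c L₁ ih =>
      simp only [List.cons_append, coact_cons] at ih ⊢
      rw [ih (hφ.cons c), ih hφ]
      abel
  map_smul L₁ L₂ r a := by
    induction L₁ generalizing x φ with
    | nil =>
      have hsmul : (fun L => φ ((r • a) :: L)) = r • (fun L => φ (a :: L)) :=
        funext fun L => hφ.map_smul [] L r a
      simp only [List.nil_append, coact_cons, E_smul, smul_lie, V.coact_smul_left hφ, hsmul,
        coact_smul, smul_add]
    | cons c L₁ ih =>
      simp only [List.cons_append, coact_cons] at ih ⊢
      rw [ih (hφ.cons c), ih hφ, smul_add]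
  map_swap L₁ L₂ a b := by
    induction L₁ generalizing x φ with
    | nil =>
      have hswap : (fun L => φ (a :: b :: L)) = fun L => φ (b :: a :: L) :=
        funext fun L => hφ.map_swap [] L a b
      have hEE : ⁅E k b, ⁅E k a, x⁆⁆ = ⁅E k a, ⁅E k b, x⁆⁆ := by
        rw [leibniz_lie, lie_E_E, zero_lie, zero_add]
      simp only [List.nil_append, coact_cons, hswap, hEE]
      abel
    | cons c L₁ ih =>
      simp only [List.cons_append, coact_cons] at ih ⊢
      rw [ih (hφ.cons c), ih hφ]

lemma coact_lie (hφ : IsSymmMultilinear k φ) (L : List J) (x y : SL2J k J) :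
    V.coact L x (fun L => V.coact L y φ) =
      V.coact L ⁅x, y⁆ φ + V.coact L y (fun L => V.coact L x φ) := by
  induction L generalizing x y φ with
  | nil =>
    have hswap : φ [x.e, y.e] = φ [y.e, x.e] := hφ.map_swap [] [] x.e y.e
    have hadd : φ [⁅x, y⁆.e] + φ [⁅E k y.e, x⁆.e] = φ [⁅E k x.e, y⁆.e] := by
      refine (hφ.map_add [] [] _ _).symm.trans (congrArg (fun a => φ [a]) ?_)
      simp only [lie_e, E, mul_zero, map_zero, LinearMap.zero_apply, mul_comm]
      module
    simp only [coact_nil, coact_cons, V.leviAction_lie x y, LinearMap.add_apply,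
      LinearMap.sub_apply, Module.End.mul_apply, map_add, hswap, ← hadd]
    abel
  | cons a L ih =>
    have hcons (w : SL2J k J) : (fun L => V.coact (a :: L) w φ) =
        (fun L => V.coact L w fun L => φ (a :: L)) + fun L => V.coact L ⁅E k a, w⁆ φ := rfl
    rw [coact_cons, coact_cons, coact_cons, hcons, hcons, coact_add, coact_add,
      ih hφ x ⁅E k a, y⁆, ih hφ ⁅E k a, x⁆ y, ih (hφ.cons a), leibniz_lie (E k a) x y,
      V.coact_add_left hφ]
    abel

instance : LieRingModule (SL2J k J) V.Coinduced where
  bracket x φ := ⟨fun L => V.coact L x φ.1, V.isSymmMultilinear_coact φ.2 x⟩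
  add_lie x y φ := Subtype.ext (funext fun L => V.coact_add_left φ.2 L x y)
  lie_add x φ ψ := Subtype.ext (funext fun L => V.coact_add L x φ.1 ψ.1)
  leibniz_lie x y φ := Subtype.ext (funext fun L => V.coact_lie φ.2 L x y)

instance : LieModule k (SL2J k J) V.Coinduced where
  smul_lie r x φ := Subtype.ext (funext fun L => V.coact_smul_left φ.2 L r x)
  lie_smul r x φ := Subtype.ext (funext fun L => V.coact_smul L x r φ.1)

namespace Coinduced

variable {V}

lemma eval_lie (x : SL2J k J) (φ : V.Coinduced) (L : List J) :
    eval ⁅x, φ⁆ L = V.coact L x (eval φ) := rfl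

lemma eval_cons (φ : V.Coinduced) (a : J) (L : List J) :
    eval φ (a :: L) = eval ⁅E k a, φ⁆ L := by
  induction L generalizing φ with
  | nil => simp [eval_lie, leviAction_apply, E]
  | cons b L ih =>
    let ψ : V.Coinduced := ⟨_, (isSymmMultilinear_eval φ).cons b⟩
    have hzero : V.coact L 0 (eval φ) = 0 := by rw [← eval_lie, zero_lie, map_zero, Pi.zero_apply]
    rw [eval_lie, coact_cons, lie_E_E, hzero, add_zero]
    exact ((isSymmMultilinear_eval φ).map_swap [] L a b).trans (ih ψ)

lemma lie_E_const (a : J) (m : M) : ⁅E k a, const V m⁆ = 0 :=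
  ext fun L => by rw [← eval_cons, eval_const_cons, map_zero, Pi.zero_apply]

lemma lie_H_const (a : J) (m : M) : ⁅H k a, const V m⁆ = const V (V.ρ a m) := by
  ext L
  cases L with
  | nil => simp [eval_lie, leviAction_apply, H]
  | cons b L => rw [eval_cons, leibniz_lie, ← lie_skew, lie_H_E]; simp [lie_E_const]

lemma isHighestWeightMap_const : V.IsHighestWeightMap (const V) := ⟨lie_E_const, lie_H_const⟩

lemma eval_nil_eq_zero_of_mem {φ : V.Coinduced} {r : ℕ}
    (hφ : φ ∈ lowerPiece J (const V) (r + 1)) : eval φ [] = 0 := by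
  suffices hle : lowerPiece J (const V) (r + 1) ≤ (LinearMap.ker (LinearMap.proj [] ∘ₗ eval)) from
    hle hφ
  refine lowerPiece_succ_le.2 fun a φ _ => ?_
  have hzero : eval φ [0] = 0 := by simpa using (isSymmMultilinear_eval φ).map_smul [] [] 0 0
  simp [eval_lie, leviAction_apply, F, hzero]

lemma eq_zero_of_mem_lowerPiece_of_mem_raisingKer {φ : V.Coinduced} {r j : ℕ} (hj : j ≤ r)
    (hφr : φ ∈ lowerPiece J (const V) r) (hφj : φ ∈ raisingKer k J V.Coinduced j) : φ = 0 := by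
  induction j generalizing φ r with
  | zero => exact hφj
  | succ j ih =>
    obtain ⟨r, rfl⟩ := Nat.exists_eq_add_of_le' (Nat.zero_lt_of_lt hj)
    ext L
    cases L with
    | nil => exact eval_nil_eq_zero_of_mem hφr
    | cons a L =>
      rw [eval_cons, ih (Nat.le_of_succ_le_succ hj)
        (isHighestWeightMap_const.lie_E_mem_lowerPiece hφr a) (mem_raisingKer_succ.1 hφj a),
        map_zero, Pi.zero_apply, Pi.zero_apply]

end Coinduced

end JSpace

end CoinducedModule

/-! ## Homomorphisms from the generalized Verma module -/

section VermaModule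

open UniversalEnvelopingAlgebra (ι lift)

lemma adjoin_range_ι (R L : Type*) [CommRing R] [LieRing L] [LieAlgebra R L] :
    Algebra.adjoin R (Set.range (ι R : L → UniversalEnvelopingAlgebra R L)) = ⊤ := by
  have hrange : Set.range (ι R : L → UniversalEnvelopingAlgebra R L) =
      UniversalEnvelopingAlgebra.mkAlgHom R L '' Set.range (TensorAlgebra.ι R) := by
    rw [← Set.range_comp]
    rfl
  rw [hrange, Algebra.adjoin_image, TensorAlgebra.adjoin_range_ι, Algebra.map_top]
  exact (AlgHom.range_eq_top _).2 Quotient.mk_surjective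

variable {k J M : Type*} [Field k] [CharZero k] [NonAssocCommRing J] [Module k J]
  [IsScalarTower k J J] [SMulCommClass k J J] [IsCommJordan J] [AddCommGroup M] [Module k M]
  {N : Type*} [AddCommGroup N] [Module k N] [LieRingModule (SL2J k J) N] [LieModule k (SL2J k J) N]

namespace JSpace

/-- The linear map `U(𝔊) ⊗ M → N`, `u ⊗ m ↦ u g(m)`, given by a linear map `g` from `M` to a
`𝔊`-module `N`. -/
def tensorLift (g : M →ₗ[k] N) : UniversalEnvelopingAlgebra k (SL2J k J) ⊗[k] M →ₗ[k] N :=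
  TensorProduct.lift
    (LinearMap.lcomp k N g ∘ₗ (lift k (LieModule.toEnd k (SL2J k J) N)).toLinearMap)

lemma tensorLift_tmul (g : M →ₗ[k] N) (u : UniversalEnvelopingAlgebra k (SL2J k J)) (m : M) :
    tensorLift g (u ⊗ₜ[k] m) = lift k (LieModule.toEnd k (SL2J k J) N) u (g m) := rfl

lemma tensorLift_smul (g : M →ₗ[k] N) (u : UniversalEnvelopingAlgebra k (SL2J k J))
    (t : UniversalEnvelopingAlgebra k (SL2J k J) ⊗[k] M) :
    tensorLift g (u • t) = lift k (LieModule.toEnd k (SL2J k J) N) u (tensorLift g t) := by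
  induction t using TensorProduct.induction_on with
  | zero => simp
  | tmul u' m =>
    rw [TensorProduct.smul_tmul', tensorLift_tmul, tensorLift_tmul, smul_eq_mul, map_mul,
      Module.End.mul_apply]
  | add x y hx hy => rw [smul_add, map_add, map_add, map_add, hx, hy]

variable {V : JSpace k J M} {g : M →ₗ[k] N}

lemma IsHighestWeightMap.tensorLift_eq_zero (hg : V.IsHighestWeightMap g)
    (t : UniversalEnvelopingAlgebra k (SL2J k J) ⊗[k] M) (ht : t ∈ V.vermaRel) :
    tensorLift g t = 0 := by
  induction ht using Submodule.span_induction with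
  | mem t ht =>
    obtain ⟨x, m, rfl⟩ := ht
    rw [map_sub, tensorLift_tmul, tensorLift_tmul, UniversalEnvelopingAlgebra.lift_ι_apply,
      map_one, LieModule.toEnd_apply_apply, hg.lie_of_f_eq_zero x.2, Module.End.one_apply]
    exact sub_self _
  | zero => rw [map_zero]
  | add x y _ _ hx hy => rw [map_add, hx, hy, add_zero]
  | smul u t _ ht => rw [tensorLift_smul, ht, map_zero]

/-- The universal property of the generalized Verma module: the homomorphism `V(M) → N` given by a
highest weight map `M → N`. -/
def IsHighestWeightMap.vermaLift (hg : V.IsHighestWeightMap g) : V.Verma →ₗ⁅k,SL2J k J⁆ N where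
  __ := (V.vermaRel.restrictScalars k).liftQ (tensorLift g) hg.tensorLift_eq_zero ∘ₗ
    (Submodule.Quotient.restrictScalarsEquiv k V.vermaRel).symm.toLinearMap
  map_lie' {x v} := by
    obtain ⟨t, rfl⟩ := Submodule.mkQ_surjective _ v
    change tensorLift g (ι k x • t) = ⁅x, tensorLift g t⁆
    rw [tensorLift_smul, UniversalEnvelopingAlgebra.lift_ι_apply, LieModule.toEnd_apply_apply]

lemma IsHighestWeightMap.vermaLift_toVerma (hg : V.IsHighestWeightMap g) (m : M) :
    hg.vermaLift (V.toVerma m) = g m := by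
  change tensorLift g (1 ⊗ₜ m) = g m
  rw [tensorLift_tmul, map_one, Module.End.one_apply]

variable (V)

lemma toVerma_injective : Function.Injective V.toVerma := fun m m' h =>
  Coinduced.const_injective (V := V) <| by
    rw [← Coinduced.isHighestWeightMap_const.vermaLift_toVerma, h,
      Coinduced.isHighestWeightMap_const.vermaLift_toVerma]

lemma smul_toVerma (u : UniversalEnvelopingAlgebra k (SL2J k J)) (m : M) :
    u • V.toVerma m = V.vermaRel.mkQ (u ⊗ₜ[k] m) := by
  rw [toVerma, LinearMap.comp_apply, LinearMap.restrictScalars_apply, ← map_smul,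
    TensorProduct.mk_apply, TensorProduct.smul_tmul', smul_eq_mul, mul_one]

lemma lie_toVerma {x : SL2J k J} (hx : x.f = 0) (m : M) :
    ⁅x, V.toVerma m⁆ = V.toVerma (V.leviAction x m) := by
  have hrel : ι k x ⊗ₜ[k] m - 1 ⊗ₜ[k] V.leviAction x m ∈ V.vermaRel :=
    Submodule.subset_span ⟨⟨x, hx⟩, m, rfl⟩
  exact (V.smul_toVerma (ι k x) m).trans ((Submodule.Quotient.eq _).2 hrel)

lemma isHighestWeightMap_toVerma : V.IsHighestWeightMap V.toVerma where
  lie_E a m := by rw [V.lie_toVerma rfl]; simp [leviAction_apply, E]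
  lie_H a m := by rw [V.lie_toVerma rfl]; simp [leviAction_apply, H]

variable {V}

lemma smul_mem_of_mem (X : LieSubmodule k (SL2J k J) V.Verma)
    (u : UniversalEnvelopingAlgebra k (SL2J k J)) {v : V.Verma} (hv : v ∈ X) : u • v ∈ X := by
  have hu : u ∈ Algebra.adjoin k (Set.range (ι k)) := by
    rw [adjoin_range_ι]
    trivial
  induction hu using Algebra.adjoin_induction generalizing v with
  | mem u hu =>
    obtain ⟨x, rfl⟩ := hu
    exact X.lie_mem hv
  | algebraMap r => rw [algebraMap_smul]; exact X.smul_mem r hv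
  | add u u' _ _ hu hu' => rw [add_smul]; exact add_mem (hu hv) (hu' hv)
  | mul u u' _ _ hu hu' => rw [mul_smul]; exact hu (hu' hv)

lemma eq_top_of_toVerma_mem {X : LieSubmodule k (SL2J k J) V.Verma}
    (hX : ∀ m, V.toVerma m ∈ X) : X = ⊤ := by
  suffices hmem : ∀ v, v ∈ X from eq_top_iff.2 fun v _ => hmem v
  intro v
  obtain ⟨t, rfl⟩ := Submodule.mkQ_surjective _ v
  induction t using TensorProduct.induction_on with
  | zero => rw [map_zero]; exact zero_mem X
  | tmul u m => rw [← smul_toVerma]; exact smul_mem_of_mem X u (hX m)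
  | add x y hx hy => rw [map_add]; exact add_mem hx hy

variable (V) in
lemma iSup_lowerPiece_toVerma : ⨆ r, lowerPiece J V.toVerma r = ⊤ :=
  (LieSubmodule.toSubmodule_eq_top _).2 <| eq_top_of_toVerma_mem
    (X := V.isHighestWeightMap_toVerma.lowerSubmodule) fun m =>
      Submodule.mem_iSup_of_mem (p := lowerPiece J V.toVerma) 0 ⟨m, rfl⟩

variable (V) in
/-- The natural map `M → V(M) → V(M)/X`. -/
def toQuotient (X : LieSubmodule k (SL2J k J) V.Verma) : M →ₗ[k] V.Verma ⧸ X :=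
  (LieSubmodule.Quotient.mk' X : V.Verma →ₗ[k] V.Verma ⧸ X) ∘ₗ V.toVerma

lemma isHighestWeightMap_toQuotient (X : LieSubmodule k (SL2J k J) V.Verma) :
    V.IsHighestWeightMap (V.toQuotient X) :=
  V.isHighestWeightMap_toVerma.comp _

lemma iSup_lowerPiece_toQuotient (X : LieSubmodule k (SL2J k J) V.Verma) :
    ⨆ r, lowerPiece J (V.toQuotient X) r = ⊤ := by
  simp only [toQuotient, ← map_lowerPiece]
  rw [← Submodule.map_iSup, iSup_lowerPiece_toVerma, Submodule.map_top, LinearMap.range_eq_top]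
  exact LieSubmodule.Quotient.surjective_mk' X

lemma ι_pow_smul (x : SL2J k J) (r : ℕ) (v : V.Verma) :
    ι k x ^ r • v = (LieModule.toEnd k (SL2J k J) V.Verma x ^ r) v := by
  induction r with
  | zero => rw [pow_zero, pow_zero, one_smul, Module.End.one_apply]
  | succ r ih =>
    rw [pow_succ', pow_succ', mul_smul, ih, Module.End.mul_apply]
    rfl

lemma ι_E_pow_mul_ι_F_pow_smul (a b : J) (r s : ℕ) (v : V.Verma) :
    (ι k (E k a) ^ r * ι k (F k b) ^ s) • v = (opE k V.Verma a ^ r) ((opF k V.Verma b ^ s) v) := by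
  rw [mul_smul, ι_pow_smul, ι_pow_smul]
  rfl

end JSpace

end VermaModule

/-! ## Dominance -/

section Dominance

variable {k J M : Type*} [Field k] [CharZero k] [NonAssocCommRing J]
  [Module k J] [IsScalarTower k J J] [SMulCommClass k J J] [IsCommJordan J] [AddCommGroup M]
  [Module k M] {N : Type*} [AddCommGroup N] [Module k N] [LieRingModule (SL2J k J) N]
  [LieModule k (SL2J k J) N] {V : JSpace k J M} {g : M →ₗ[k] N} {n : ℕ}

namespace JSpace

namespace IsHighestWeightMap

lemma opE_one_pow_opF_pow_eq_zero_iff (hg : V.IsHighestWeightMap g) (hinj : Function.Injective g)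
    (a : J) (r : ℕ) :
    (∀ m, (opE k N (1 : J) ^ (r + 1)) ((opF k N a ^ (r + 1)) (g m)) = 0) ↔
      newtonSum (fun i => V.ρ (jpow a i)) r 1 = 0 := by
  simp only [hg.opE_one_pow_opF_pow, ← Nat.cast_smul_eq_nsmul k, smul_eq_zero, Nat.cast_eq_zero,
    Nat.factorial_ne_zero, false_or, map_eq_zero_iff g hinj, LinearMap.ext_iff,
    LinearMap.zero_apply]

lemma hasBoundedQuotient [Nontrivial M] (hg : V.IsHighestWeightMap g) (hn : V.IsOfLevel n)
    (hinj : Function.Injective g) (hbot : lowerPiece J g (n + 1) = ⊥) :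
    V.HasBoundedQuotient n := by
  set X := hg.vermaLift.ker
  have hinjX : Function.Injective (V.toQuotient X) := by
    refine (injective_iff_map_eq_zero _).2 fun m hm => hinj ?_
    have hmX : V.toVerma m ∈ X := (LieSubmodule.Quotient.mk_eq_zero' (N := X)).1 hm
    rw [map_zero, ← hg.vermaLift_toVerma]
    exact LieModuleHom.mem_ker.1 hmX
  have hlower : lowerPiece J V.toVerma (n + 1) ≤ (X : Submodule k V.Verma) := fun v hv => by
    have hcomp : (hg.vermaLift : V.Verma →ₗ[k] N) ∘ₗ V.toVerma = g :=
      LinearMap.ext hg.vermaLift_toVerma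
    have hmap := Submodule.mem_map_of_mem (f := (hg.vermaLift : V.Verma →ₗ[k] N)) hv
    rw [map_lowerPiece, hcomp, hbot] at hmap
    exact LieModuleHom.mem_ker.2 hmap
  have hbotX : lowerPiece J (V.toQuotient X) (n + 1) = ⊥ := by
    rw [toQuotient, ← map_lowerPiece, ← le_bot_iff, Submodule.map_le_iff_le_comap]
    exact fun v hv => (LieSubmodule.Quotient.mk_eq_zero' (N := X)).2 (hlower hv)
  exact ⟨X, (isHighestWeightMap_toQuotient X).isBoundedOfLevel hn (iSup_lowerPiece_toQuotient X)
    hinjX hbotX, hinjX⟩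

end IsHighestWeightMap

lemma IsDominant.hasBoundedQuotient [Nontrivial M] (h : V.IsDominant n) (hn : V.IsOfLevel n) :
    V.HasBoundedQuotient n := by
  obtain ⟨N, _, _, _, _, hN, φ, hφ⟩ := h
  have hg : V.IsHighestWeightMap ((weightSpace k J N n).subtype ∘ₗ φ.toLinearMap) :=
    { lie_E := fun a m => by
        have hE := lie_mem_weightSpace (E_mem_weightSpace (k := k) a) (φ m).2
        rwa [hN.weightSpace_eq_bot (by simp), Submodule.mem_bot] at hE
      lie_H := fun a m => (hφ a m).symm }
  exact hg.hasBoundedQuotient hn (Subtype.val_injective.comp φ.injective)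
    (hg.lowerPiece_eq_bot hn hN)

lemma HasBoundedQuotient.isDominant (h : V.HasBoundedQuotient n) (hn : V.IsOfLevel n) :
    V.IsDominant n := by
  obtain ⟨X, hX, hinj⟩ := h
  have hg := isHighestWeightMap_toQuotient X
  have hrange := hg.range_eq_weightSpace hn (iSup_lowerPiece_toQuotient X)
  exact ⟨V.Verma ⧸ X, inferInstance, inferInstance, inferInstance, inferInstance, hX,
    (LinearEquiv.ofInjective (V.toQuotient X) hinj).trans (LinearEquiv.ofEq _ _ hrange),
    fun a m => (hg.lie_H a m).symm⟩

lemma HasBoundedQuotient.newtonSum_eq_zero (h : V.HasBoundedQuotient n) (hn : V.IsOfLevel n)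
    (a : J) : newtonSum (fun i => V.ρ (jpow a i)) n 1 = 0 := by
  obtain ⟨X, hX, hinj⟩ := h
  have hg := isHighestWeightMap_toQuotient X
  refine (hg.opE_one_pow_opF_pow_eq_zero_iff hinj a n).1 fun m => ?_
  have hF := opF_pow_apply_mem_lowerPiece (V.toQuotient X) a m (n + 1)
  rw [hg.lowerPiece_eq_bot hn hX, Submodule.mem_bot] at hF
  rw [hF, map_zero]

lemma Coinduced.lowerPiece_const_eq_bot
    (h : ∀ a : J, newtonSum (fun i => V.ρ (jpow a i)) n 1 = 0) :
    lowerPiece J (Coinduced.const V) (n + 1) = ⊥ := by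
  have hg := Coinduced.isHighestWeightMap_const (V := V)
  have hkill : lowerPiece J (Coinduced.const V) (n + 1) ≤
      LinearMap.ker (opE k V.Coinduced (1 : J) ^ (n + 1)) :=
    lowerPiece_le_of_forall_pow fun a =>
      (hg.opE_one_pow_opF_pow_eq_zero_iff Coinduced.const_injective a n).2 (h a)
  refine (Submodule.eq_bot_iff _).2 fun φ hφ => ?_
  exact Coinduced.eq_zero_of_mem_lowerPiece_of_mem_raisingKer le_rfl hφ <|
    opE_one_pow_apply_mem_raisingKer (s := 0)
      (fun c v hv => hg.lie_mem_lowerPiece rfl rfl hv) (fun v hv => hkill hv) hφ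

end JSpace

end Dominance

end JordanSL2

end

theorem theorem2_general {k : Type*} [Field k] [CharZero k]
    {J : Type*} [NonAssocCommRing J] [Module k J] [IsScalarTower k J J] [SMulCommClass k J J]
    [IsCommJordan J] {M : Type*} [AddCommGroup M] [Module k M] [Nontrivial M]
    (V : JordanSL2.JSpace k J M) (n : ℕ) (hn : V.IsOfLevel n) :
    List.TFAE [
      V.IsDominant n,
      V.HasBoundedQuotient n,
      ∀ (a : J) (m : M),
        ((UniversalEnvelopingAlgebra.ι k (JordanSL2.SL2J.E k (1 : J))) ^ (n + 1) *
          (UniversalEnvelopingAlgebra.ι k (JordanSL2.SL2J.F k a)) ^ (n + 1)) • V.toVerma m = 0,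
      ∀ a : J, ∑ σ : (n + 1).Partition,
        (JordanSL2.signPartition σ * ((JordanSL2.conjClass σ).card : ℤ)) •
          V.ρPartition σ a = 0] := by
  simp only [JordanSL2.JSpace.sum_conjClass_smul_ρPartition,
    JordanSL2.JSpace.ι_E_pow_mul_ι_F_pow_smul]
  tfae_have 1 → 2 := fun h => h.hasBoundedQuotient hn
  tfae_have 2 → 1 := fun h => h.isDominant hn
  tfae_have 3 ↔ 4 := forall_congr' fun a =>
    V.isHighestWeightMap_toVerma.opE_one_pow_opF_pow_eq_zero_iff V.toVerma_injective a n
  tfae_have 2 → 4 := fun h => h.newtonSum_eq_zero hn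
  tfae_have 4 → 2 := fun h =>
    JordanSL2.JSpace.Coinduced.isHighestWeightMap_const.hasBoundedQuotient hn
      JordanSL2.JSpace.Coinduced.const_injective
      (JordanSL2.JSpace.Coinduced.lowerPiece_const_eq_bot h)
  tfae_finish

theorem theorem2 {k : Type*} [Field k] [IsAlgClosed k] [CharZero k]
    {J : Type*} [NonAssocCommRing J] [Module k J] [IsScalarTower k J J] [SMulCommClass k J J]
    [IsCommJordan J] {M : Type*} [AddCommGroup M] [Module k M] [Nontrivial M]
    (V : JordanSL2.JSpace k J M) (n : ℕ) (hn : V.IsOfLevel n) :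
    List.TFAE [
      V.IsDominant n,
      V.HasBoundedQuotient n,
      ∀ (a : J) (m : M),
        ((UniversalEnvelopingAlgebra.ι k (JordanSL2.SL2J.E k (1 : J))) ^ (n + 1) *
          (UniversalEnvelopingAlgebra.ι k (JordanSL2.SL2J.F k a)) ^ (n + 1)) • V.toVerma m = 0,
      ∀ a : J, ∑ σ : (n + 1).Partition,
        (JordanSL2.signPartition σ * ((JordanSL2.conjClass σ).card : ℤ)) • V.ρPartition σ a = 0] :=
  theorem2_general V n hn
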